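/- Let $(M,\tau)$ be a tracial $W^*$-probability space (a $W^*$-algebra with a faithful normal tracial state). Tuples $X=(x_1,\dots,x_n)\in M^n$ are always assumed closed under the adjoint: for each $i$ there is $j$ with $x_i^*=x_j$. **Definitions.** Let $B\subset M$ be a unital $*$-subalgebra. Let $B\langle X\rangle\subset M$ be the algebra generated by $B$ and $X$, let $B\langle T\rangle$ be the algebra freely generated by $B$ and indeterminates $t_1,\dots,t_n$, and let $\mathrm{ev}_X\colon B\langle T\rangle\to B\langle X\rangle$ be the unital homomorphism that is the identity on $B$ and sends $t_i$ to $x_i$; use the same symbol for the induced map on $B\langle T\rangle\otimes B\langle T\rangle^\circ$. Let $\partial_i\colon B\langle T\rangle\to B\langle T\rangle\otimes B\langle T\rangle^\circ$ be the linear map that satisfies the Leibniz rule, vanishes on $B$ and has $\partial_i t_j=\delta_{i=j}\,1\otimes 1$; for $P\in B\langle T\rangle^n$ let $\mathscr J(P)=[\partial_kP_j]_{j,k}$. For $\Xi\in L^2(M)^n$, a *free Stein kernel* of $X$ relative to $\Xi$ over $B$ is a matrix $A\in M_n(L^2(B\langle X\rangle\otimes B\langle X\rangle^\circ))$ with $$\sum_{j}\langle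 \Xi_j,\mathrm{ev}_X P_j\rangle_2=\sum_{j,k}\langle A_{jk},\mathrm{ev}_X(\partial_kP_j)\rangle_2\qquad\text{for all }P\in B\langle T\rangle^n .$$ Put $\Sigma^*(X\mid\Xi:B)=\inf_A\|A-\mathbb 1\|_{HS}$, the infimum over all such $A$ ($+\infty$ if there are none), where $\mathbb 1$ is the diagonal matrix with diagonal entries $1\otimes 1$. The *free Stein irregularity* is $\Sigma^*(X:B)=\inf_{\Xi\in L^2(M)^n}\Sigma^*(X\mid\Xi:B)$, which is finite, and the *free Stein dimension* is $\sigma(X:B)=n-\Sigma^*(X:B)^2$. Write $\Sigma^*(X)$, $\sigma(X)$ when $B=\mathbb C$. For unital $*$-subalgebras $B,C\subset M$, $B\vee C$ is the $*$-algebra they generate. **Theorem.** Let $B,C\subset M$ be unital $*$-subalgebras and $X\in M^n$, $Y\in M^m$ tuples as above. 1. $$\Sigma^*(X:B)^2+\Sigma^*(Y:C)^2\le\Sigma^*(X,Y:B\vee C)^2\le\Sigma^*(X:(B\vee C)\langle Y\rangle)^2+\Sigma^*(Y:(B\vee C)\langle X\rangle)^2 .$$ 2. $$\sigma(X:(B\vee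 C)\langle Y\rangle)+\sigma(Y:(B\vee C)\langle X\rangle)\le\sigma(X,Y:B\vee C)\le\sigma(X:B)+\sigma(Y:C).$$ 3. Let $D\subset B\cap C$ be a unital $*$-subalgebra with a trace-preserving conditional expectation $\mathcal E\colon(B\vee C)\langle X,Y\rangle\to D$. If $B\langle X\rangle$ and $C\langle Y\rangle$ are free with amalgamation over $D$ with respect to $\mathcal E$, then all inequalities in 1 and 2 are equalities. 4. If there is a trace-preserving conditional expectation $\mathcal E\colon B\langle X,Y\rangle\to B$ with respect to which $B\langle X\rangle$ and $B\langle Y\rangle$ are free with amalgamation over $B$, then $\Sigma^*(X,Y:B)^2=\Sigma^*(X:B)^2+\Sigma^*(Y:B)^2$ and $\sigma(X,Y:B)=\sigma(X:B)+\sigma(Y:B)$. 5. If $X$ and $Y$ are free, that is, $\mathbb C\langle X\rangle$ and $\mathbb C\langle Y\rangle$ are freely independent with respect to $\tau$, then $\Sigma^*(X,Y)^2=\Sigma^*(X)^2+\Sigma^*(Y)^2$ and $\sigma(X,Y)=\sigma(X)+\sigma(Y)$. -/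

import Mathlib

open scoped TensorProduct ComplexOrder ENNReal

noncomputable section

universe u

/-! ### Tracial W*-probability spaces and their `L²`-spaces -/

section WStar

variable {M : Type u} [CStarAlgebra M] [PartialOrder M] [StarOrderedRing M]

/-- `τ` is a faithful normal tracial state. A W*-algebra `M` with such a `τ` is a tracial
W*-probability space. Normality is preservation of suprema of bounded increasing families
of self-adjoint elements. -/
structure IsFaithfulNormalTracialState (τ : M →ₚ[ℂ] ℂ) : Prop where
  map_one : τ 1 = 1
  tracial : ∀ x y : M, τ (x * y) = τ (y * x)
  faithful : ∀ x : M, τ (star x * x) = 0 → x = 0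
  normal : ∀ (S : Set M) (s : M), S.Nonempty → (∀ x ∈ S, IsSelfAdjoint x) →
    DirectedOn (· ≤ ·) S → IsLUB S s → IsLUB (τ '' S) (τ s)

/-- The canonical map of `M` into `L²(M)`, the GNS Hilbert space of `τ`, in which
`⟨x, y⟩ = τ(x* y)`. -/
def toL2 (τ : M →ₚ[ℂ] ℂ) : M →ₗ[ℂ] τ.GNS :=
  (UniformSpace.Completion.toComplₗᵢ (𝕜 := ℂ) (E := τ.PreGNS)).toLinearMap ∘ₗ
    τ.toPreGNS.toLinearMap

/-- `L²(M ⊗ M°)` for the trace `τ ⊗ τ°`, i.e. the Hilbert space tensor product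
`L²(M) ⊗ L²(M°)`. The linear map `b° ↦ b` identifies `L²(M°)` with `L²(M)`, because
`τ°((b°)* d°) = τ(d b*) = τ(b* d)`, so the second leg is written as `L²(M)`. -/
abbrev L2Tensor (τ : M →ₚ[ℂ] ℂ) : Type u :=
  UniformSpace.Completion (τ.GNS ⊗[ℂ] τ.GNS)

/-- The canonical map of the algebraic tensor product into `L²(M ⊗ M°)`; here `a ⊗ b` stands
for `a ⊗ b°`. -/
def tensorToL2 (τ : M →ₚ[ℂ] ℂ) : M ⊗[ℂ] M →ₗ[ℂ] L2Tensor τ :=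
  (UniformSpace.Completion.toComplₗᵢ (𝕜 := ℂ) (E := τ.GNS ⊗[ℂ] τ.GNS)).toLinearMap ∘ₗ
    TensorProduct.map (toL2 τ) (toL2 τ)

theorem inner_toL2 (τ : M →ₚ[ℂ] ℂ) (x y : M) :
    inner ℂ (toL2 τ x) (toL2 τ y) = τ (star x * y) :=
  UniformSpace.Completion.inner_coe (𝕜 := ℂ) (τ.toPreGNS x) (τ.toPreGNS y)

theorem inner_tensorToL2 (τ : M →ₚ[ℂ] ℂ) (a b c d : M) :
    inner ℂ (tensorToL2 τ (a ⊗ₜ b)) (tensorToL2 τ (c ⊗ₜ d)) =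
      τ (star a * c) * τ (star b * d) := by
  rw [← inner_toL2, ← inner_toL2]
  exact UniformSpace.Completion.inner_coe (𝕜 := ℂ)
    (toL2 τ a ⊗ₜ[ℂ] toL2 τ b) (toL2 τ c ⊗ₜ[ℂ] toL2 τ d)

/-- `L²(A ⊗ A°)` as a closed subspace of `L²(M ⊗ M°)`, for a `*`-subalgebra `A` of `M`. -/
def L2TensorOf (τ : M →ₚ[ℂ] ℂ) (A : StarSubalgebra ℂ M) : Submodule ℂ (L2Tensor τ) :=
  (Submodule.span ℂ
    {z | ∃ a ∈ A, ∃ b ∈ A, z = tensorToL2 τ (a ⊗ₜ[ℂ] b)}).topologicalClosure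

/-- `⟨A, B⟩_HS` for matrices with entries in `L²(M ⊗ M°)`. -/
def hsInner {I : Type*} [Fintype I] {τ : M →ₚ[ℂ] ℂ} (A B : Matrix I I (L2Tensor τ)) : ℂ :=
  ∑ j, ∑ k, inner ℂ (A j k) (B j k)

/-- `‖A‖_HS` for matrices with entries in `L²(M ⊗ M°)`. -/
def hsNorm {I : Type*} [Fintype I] {τ : M →ₚ[ℂ] ℂ} (A : Matrix I I (L2Tensor τ)) : ℝ :=
  Real.sqrt (∑ j, ∑ k, ‖A j k‖ ^ 2)

/-- The diagonal matrix with all diagonal entries `1 ⊗ 1`. -/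
def hsOne {I : Type*} [DecidableEq I] (τ : M →ₚ[ℂ] ℂ) : Matrix I I (L2Tensor τ) :=
  Matrix.diagonal fun _ => tensorToL2 τ (1 ⊗ₜ[ℂ] 1)

end WStar

/-! ### The algebra `R⟨T⟩` and the free difference quotients -/

section Polynomials

variable (R : Type*) [Ring R] [Algebra ℂ R] (I : Type*)

/-- The relations saying that the generators indexed by `R` form a copy of the unital
algebra `R`. -/
inductive NCPolyRel : FreeAlgebra ℂ (R ⊕ I) → FreeAlgebra ℂ (R ⊕ I) → Prop
  | add (a b : R) : NCPolyRel (FreeAlgebra.ι ℂ (Sum.inl (a + b)))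
      (FreeAlgebra.ι ℂ (Sum.inl a) + FreeAlgebra.ι ℂ (Sum.inl b))
  | mul (a b : R) : NCPolyRel (FreeAlgebra.ι ℂ (Sum.inl (a * b)))
      (FreeAlgebra.ι ℂ (Sum.inl a) * FreeAlgebra.ι ℂ (Sum.inl b))
  | scalar (c : ℂ) : NCPolyRel (FreeAlgebra.ι ℂ (Sum.inl (algebraMap ℂ R c)))
      (algebraMap ℂ (FreeAlgebra ℂ (R ⊕ I)) c)

/-- `R⟨T⟩`: the unital complex algebra freely generated by the algebra `R` and indeterminates
`t i`, `i : I`; the indeterminates commute neither with `R` nor with each other. -/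
abbrev NCPoly : Type _ := RingQuot (NCPolyRel R I)

namespace NCPoly

variable {R I}

/-- The inclusion of the coefficient algebra. -/
def coeff : R →ₐ[ℂ] NCPoly R I :=
  AlgHom.ofLinearMap
    { toFun := fun a => RingQuot.mkAlgHom ℂ (NCPolyRel R I) (FreeAlgebra.ι ℂ (Sum.inl a))
      map_add' := fun a b => by
        rw [← map_add]; exact RingQuot.mkAlgHom_rel ℂ (NCPolyRel.add a b)
      map_smul' := fun c a => by
        have h1 := RingQuot.mkAlgHom_rel ℂ (NCPolyRel.mul (I := I) (algebraMap ℂ R c) a)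
        have h2 := RingQuot.mkAlgHom_rel ℂ (NCPolyRel.scalar (R := R) (I := I) c)
        rw [Algebra.smul_def, h1, map_mul, h2, AlgHom.commutes, ← Algebra.smul_def]
        rfl }
    (by
      have h := RingQuot.mkAlgHom_rel ℂ (NCPolyRel.scalar (R := R) (I := I) 1)
      simpa using h)
    (fun a b => by
      have h := RingQuot.mkAlgHom_rel ℂ (NCPolyRel.mul (I := I) a b)
      simpa using h)

/-- The indeterminate `t i`. -/
def var (i : I) : NCPoly R I :=
  RingQuot.mkAlgHom ℂ (NCPolyRel R I) (FreeAlgebra.ι ℂ (Sum.inr i))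

/-- The universal property of `R⟨T⟩`. -/
def lift {S : Type*} [Semiring S] [Algebra ℂ S] (f : R →ₐ[ℂ] S) (x : I → S) : NCPoly R I →ₐ[ℂ] S :=
  RingQuot.liftAlgHom ℂ (s := NCPolyRel R I)
    ⟨FreeAlgebra.lift ℂ (Sum.elim f x), by
      intro p q h
      cases h <;> simp⟩

@[simp]
theorem lift_coeff {S : Type*} [Semiring S] [Algebra ℂ S] (f : R →ₐ[ℂ] S) (x : I → S) (a : R) :
    lift f x (coeff a) = f a := by
  simp [lift, coeff]

@[simp]
theorem lift_var {S : Type*} [Semiring S] [Algebra ℂ S] (f : R →ₐ[ℂ] S) (x : I → S) (i : I) :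
    lift f x (var i) = x i := by
  simp [lift, var]

theorem induction {P : NCPoly R I → Prop} (hcoeff : ∀ a, P (coeff a)) (hvar : ∀ i, P (var i))
    (hadd : ∀ p q, P p → P q → P (p + q)) (hmul : ∀ p q, P p → P q → P (p * q))
    (p : NCPoly R I) : P p := by
  obtain ⟨p, rfl⟩ := RingQuot.mkAlgHom_surjective ℂ (NCPolyRel R I) p
  induction p using FreeAlgebra.induction with
  | grade0 c =>
    have h := hcoeff (algebraMap ℂ R c)
    rwa [AlgHom.commutes, ← AlgHom.commutes (RingQuot.mkAlgHom ℂ (NCPolyRel R I)) c] at h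
  | grade1 s =>
    cases s with
    | inl a => exact hcoeff a
    | inr i => exact hvar i
  | mul a b ha hb => rw [map_mul]; exact hmul _ _ ha hb
  | add a b ha hb => rw [map_add]; exact hadd _ _ ha hb

variable [DecidableEq I]

/-- The algebra homomorphism sending `p` to the upper triangular matrix with diagonal entries
`p ⊗ 1`, `1 ⊗ p` and with the free difference quotient `∂ i p` above the diagonal. -/
def diffHom (i : I) : NCPoly R I →ₐ[ℂ] Matrix (Fin 2) (Fin 2) (NCPoly R I ⊗[ℂ] NCPoly R I) :=
  lift
    ((Matrix.diagonalAlgHom (n := Fin 2) (α := NCPoly R I ⊗[ℂ] NCPoly R I) ℂ).comp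
      (AlgHom.pi (R := ℂ) (A := fun _ : Fin 2 => NCPoly R I ⊗[ℂ] NCPoly R I)
        ![Algebra.TensorProduct.includeLeft.comp coeff,
          Algebra.TensorProduct.includeRight.comp coeff]))
    (fun j => !![var j ⊗ₜ 1, if j = i then 1 ⊗ₜ 1 else 0; 0, 1 ⊗ₜ var j])

/-- The free difference quotient `∂ i : R⟨T⟩ → R⟨T⟩ ⊗ R⟨T⟩°`; the linear space underlying
`R⟨T⟩ ⊗ R⟨T⟩°` is written `R⟨T⟩ ⊗ R⟨T⟩`. It is the linear map characterised by
`diff_coeff`, `diff_var` and the Leibniz rule `diff_mul`. -/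
def diff (i : I) : NCPoly R I →ₗ[ℂ] NCPoly R I ⊗[ℂ] NCPoly R I :=
  Matrix.entryLinearMap ℂ (NCPoly R I ⊗[ℂ] NCPoly R I) (0 : Fin 2) (1 : Fin 2) ∘ₗ
    (diffHom i).toLinearMap

theorem diffHom_entries (i : I) (p : NCPoly R I) :
    diffHom i p 0 0 = p ⊗ₜ 1 ∧ diffHom i p 1 0 = 0 ∧ diffHom i p 1 1 = 1 ⊗ₜ p := by
  induction p using NCPoly.induction with
  | hcoeff a => simp [diffHom]
  | hvar j => simp [diffHom]
  | hadd p q hp hq =>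
    simp [hp, hq, TensorProduct.add_tmul, TensorProduct.tmul_add]
  | hmul p q hp hq =>
    simp [Matrix.mul_apply, hp, hq]

@[simp]
theorem diff_coeff (i : I) (a : R) : diff i (coeff a : NCPoly R I) = 0 := by
  simp [diff, diffHom]

@[simp]
theorem diff_var (i j : I) :
    diff i (var j : NCPoly R I) = if j = i then 1 ⊗ₜ 1 else 0 := by
  simp [diff, diffHom]

/-- The Leibniz rule `∂(pq) = ∂(p)·q + p·∂(q)`, where `p·(a ⊗ b)·q = pa ⊗ bq`. -/
theorem diff_mul (i : I) (p q : NCPoly R I) :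
    diff i (p * q) = diff i p * (1 ⊗ₜ q) + (p ⊗ₜ 1) * diff i q := by
  have hp := diffHom_entries i p
  have hq := diffHom_entries i q
  simp [diff, Matrix.mul_apply, hp, hq, add_comm]

end NCPoly

end Polynomials

/-! ### Free Stein kernels, free Stein irregularity, free Stein dimension -/

section Stein

variable {M : Type u} [CStarAlgebra M] {I : Type*}

/-- `B⟨X⟩`, the `*`-subalgebra of `M` generated by `B` and the entries of `X`. -/
def adjoinTuple (B : StarSubalgebra ℂ M) (X : I → M) : StarSubalgebra ℂ M :=
  B ⊔ StarAlgebra.adjoin ℂ (Set.range X)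

/-- The set of entries of `X` is closed under the adjoint. -/
def IsStarClosed (X : I → M) : Prop :=
  ∀ i, ∃ j, star (X i) = X j

/-- The evaluation `ev_X : B⟨T⟩ → M`, the identity on `B` and sending `t i` to `X i`. -/
def evTuple (B : StarSubalgebra ℂ M) (X : I → M) : NCPoly B I →ₐ[ℂ] M :=
  NCPoly.lift B.subtype.toAlgHom X

/-- For a tuple closed under the adjoint, `ev_X` maps `B⟨T⟩` onto `B⟨X⟩`. -/
theorem range_evTuple (B : StarSubalgebra ℂ M) {X : I → M} (hX : IsStarClosed X) :
    (evTuple B X).range = (adjoinTuple B X).toSubalgebra := by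
  apply le_antisymm
  · rintro _ ⟨p, rfl⟩
    change evTuple B X p ∈ adjoinTuple B X
    induction p using NCPoly.induction with
    | hcoeff a =>
      simp only [evTuple, NCPoly.lift_coeff]
      exact (le_sup_left : B ≤ adjoinTuple B X) a.2
    | hvar i =>
      simp only [evTuple, NCPoly.lift_var]
      exact (le_sup_right : _ ≤ adjoinTuple B X)
        (StarAlgebra.subset_adjoin ℂ _ (Set.mem_range_self i))
    | hadd p q hp hq => rw [map_add]; exact add_mem hp hq
    | hmul p q hp hq => rw [map_mul]; exact mul_mem hp hq
  · have hcoeff : ∀ b ∈ B, b ∈ (evTuple B X).range := fun b hb =>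
      ⟨NCPoly.coeff ⟨b, hb⟩, by simp [evTuple]⟩
    have hvar : ∀ i, X i ∈ (evTuple B X).range := fun i => ⟨NCPoly.var i, by simp [evTuple]⟩
    have hstar : ∀ y ∈ (evTuple B X).range, star y ∈ (evTuple B X).range := by
      rintro _ ⟨p, rfl⟩
      change star (evTuple B X p) ∈ (evTuple B X).range
      induction p using NCPoly.induction with
      | hcoeff a =>
        simp only [evTuple, NCPoly.lift_coeff]
        exact hcoeff _ (star_mem a.2)
      | hvar i =>
        obtain ⟨j, hj⟩ := hX i
        simp only [evTuple, NCPoly.lift_var]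
        rw [hj]
        exact hvar j
      | hadd p q hp hq => rw [map_add, star_add]; exact add_mem hp hq
      | hmul p q hp hq => rw [map_mul, star_mul]; exact mul_mem hq hp
    let S : StarSubalgebra ℂ M :=
      { (evTuple B X).range with star_mem' := fun {y} hy => hstar y hy }
    have h : adjoinTuple B X ≤ S :=
      sup_le (fun b hb => hcoeff b hb)
        (StarAlgebra.adjoin_le (by rintro _ ⟨i, rfl⟩; exact hvar i))
    exact fun y hy => h hy

variable [PartialOrder M] [StarOrderedRing M]

/-- The matrix `ev_X (𝒥 P)` of the non-commutative Jacobian, whose `(j, k)` entry is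
`ev_X (∂ k (P j))`. -/
def evJacobian [DecidableEq I] (τ : M →ₚ[ℂ] ℂ) (B : StarSubalgebra ℂ M) (X : I → M)
    (P : I → NCPoly B I) : Matrix I I (L2Tensor τ) :=
  Matrix.of fun j k => tensorToL2 τ
    (TensorProduct.map (evTuple B X).toLinearMap (evTuple B X).toLinearMap
      (NCPoly.diff k (P j)))

variable [Fintype I] [DecidableEq I]

/-- `A` is a free Stein kernel of `X` relative to `Ξ` over `B`. -/
structure IsFreeSteinKernel (τ : M →ₚ[ℂ] ℂ) (X : I → M) (B : StarSubalgebra ℂ M)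
    (Ξ : I → τ.GNS) (A : Matrix I I (L2Tensor τ)) : Prop where
  entry_mem : ∀ j k, A j k ∈ L2TensorOf τ (adjoinTuple B X)
  inner_eq : ∀ P : I → NCPoly B I,
    ∑ j, inner ℂ (Ξ j) (toL2 τ (evTuple B X (P j))) = hsInner A (evJacobian τ B X P)

/-- The free Stein discrepancy `Σ*(X | Ξ : B)`, equal to `∞` when there is no kernel. -/
def freeSteinDiscrepancy (τ : M →ₚ[ℂ] ℂ) (X : I → M) (B : StarSubalgebra ℂ M)
    (Ξ : I → τ.GNS) : ℝ≥0∞ :=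
  ⨅ (A : Matrix I I (L2Tensor τ)) (_ : IsFreeSteinKernel τ X B Ξ A),
    ENNReal.ofReal (hsNorm (A - hsOne τ))

/-- The free Stein irregularity `Σ*(X : B)`. -/
def freeSteinIrregularity (τ : M →ₚ[ℂ] ℂ) (X : I → M) (B : StarSubalgebra ℂ M) : ℝ≥0∞ :=
  ⨅ Ξ : I → τ.GNS, freeSteinDiscrepancy τ X B Ξ

/-- The free Stein irregularity is always finite. -/
theorem freeSteinIrregularity_ne_top (τ : M →ₚ[ℂ] ℂ) (X : I → M) (B : StarSubalgebra ℂ M) :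
    freeSteinIrregularity τ X B ≠ ∞ := by
  have hker : IsFreeSteinKernel τ X B 0 0 :=
    ⟨fun _ _ => Submodule.zero_mem _, fun P => by simp [hsInner]⟩
  exact ne_top_of_le_ne_top ENNReal.ofReal_ne_top
    ((iInf_le _ 0).trans (iInf₂_le (0 : Matrix I I (L2Tensor τ)) hker))

/-- The free Stein dimension `σ(X : B) = n - Σ*(X : B)²` of an `n`-tuple `X`. -/
def freeSteinDim (τ : M →ₚ[ℂ] ℂ) (X : I → M) (B : StarSubalgebra ℂ M) : ℝ :=
  (Fintype.card I : ℝ) - (freeSteinIrregularity τ X B).toReal ^ 2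

end Stein

/-! ### Freeness -/

section Freeness

variable {M : Type u} [CStarAlgebra M] [PartialOrder M] [StarOrderedRing M]

/-- `E` is a trace-preserving conditional expectation of the `*`-algebra `N` onto its
`*`-subalgebra `D`. -/
structure IsTracePreservingCondExp (τ : M →ₚ[ℂ] ℂ) (N D : StarSubalgebra ℂ M)
    (E : N →ₗ[ℂ] D) : Prop where
  le : D ≤ N
  map_of_mem : ∀ x : N, (x : M) ∈ D → (E x : M) = x
  bimodule : ∀ d x d' : N, (d : M) ∈ D → (d' : M) ∈ D →
    (E (d * x * d') : M) = d * E x * d'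
  nonneg : ∀ x : N, (0 : M) ≤ E (star x * x)
  trace : ∀ x : N, τ (E x) = τ x

/-- The `*`-algebras `A₁, A₂ ⊆ N` containing `D` are free with amalgamation over `D` with
respect to `E`: the expectation of a nonempty product of centred elements taken alternately
from `A₁` (label `false`) and `A₂` (label `true`) is zero. -/
structure IsFreeWithAmalgamation {N D : StarSubalgebra ℂ M} (E : N →ₗ[ℂ] D)
    (A₁ A₂ : StarSubalgebra ℂ M) : Prop where
  le_left : D ≤ A₁
  le_right : D ≤ A₂
  left_le : A₁ ≤ N
  right_le : A₂ ≤ N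
  alternating : ∀ w : List (Bool × N), w ≠ [] →
    w.IsChain (fun p q => p.1 ≠ q.1) →
    (∀ p ∈ w, (p.2 : M) ∈ (if p.1 then A₂ else A₁) ∧ E p.2 = 0) →
    E (w.map Prod.snd).prod = 0

/-- The `*`-algebras `A₁, A₂ ⊆ M` are freely independent with respect to `τ`. -/
def IsFreelyIndependent (τ : M →ₚ[ℂ] ℂ) (A₁ A₂ : StarSubalgebra ℂ M) : Prop :=
  ∀ w : List (Bool × M), w ≠ [] →
    w.IsChain (fun p q => p.1 ≠ q.1) →
    (∀ p ∈ w, p.2 ∈ (if p.1 then A₂ else A₁) ∧ τ p.2 = 0) →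
    τ (w.map Prod.snd).prod = 0

end Freeness

end

/-! The defining identity of a free Stein kernel splits over the components of `P`, so a kernel is a
matrix whose rows satisfy independent conditions (`IsSteinRow`, `isFreeSteinKernel_iff`). All three
comparisons of squared irregularities come from moving rows between tuples and coefficient algebras.

Lower bound: a row for `(X, Y)` over `B ∨ C`, tested only on polynomials in `X` with coefficients in
`B`, does not see its `Y` entries. Projecting the remaining entries onto `L²(B⟨X⟩ ⊗ B⟨X⟩°)` changes
no test value and brings nothing further from `1 ⊗ 1` or `0`, as both lie in that subspace
(`IsSteinRow.restrict`). Upper bound: if `Y` is regarded as part of the coefficients, the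
derivatives in the `X` variables are unchanged, so a row for `X` over `(B ∨ C)⟨Y⟩`, padded by zeros,
is a row for `(X, Y)` (`IsSteinRow.extend`). A block diagonal matrix of such rows is a kernel.

Under freeness the two outer bounds meet, because a row for `X` over `B` with `ξ ∈ L²(B⟨X⟩)` is also
a row over `R = B ∨ C⟨Y⟩` (`IsSteinRow.of_free`). Indeed `R⟨T⟩` is spanned by `D` and by alternating
words in `B⟨T⟩` and `C⟨Y⟩` whose letters are centred after evaluation. Without a letter from `C⟨Y⟩`
such a word lies in `B⟨T⟩`, where the identity is known. Otherwise both sides vanish: the word is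
orthogonal to `B⟨X⟩`, and each Leibniz term of its derivative keeps a `C⟨Y⟩` letter in one leg,
which makes it orthogonal to `L²(B⟨X⟩ ⊗ B⟨X⟩°)`. -/

/-! ### Spanning by alternating centred words -/

/-- An alternating word of elements of `A false` and `A true` that are centred for `e`. -/
structure IsAlternatingCentred {S D : Type*} [Ring S] [Algebra ℂ S] [Ring D] [Algebra ℂ D]
    (e : S →ₗ[ℂ] D) (A : Bool → Subalgebra ℂ S) (w : List (Bool × S)) : Prop where
  chain : w.IsChain (fun p q => p.1 ≠ q.1)
  mem : ∀ p ∈ w, p.2 ∈ A p.1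
  centred : ∀ p ∈ w, e p.2 = 0

section Words

variable {S D : Type*} [Ring S] [Algebra ℂ S] [Ring D] [Algebra ℂ D]
  {e : S →ₗ[ℂ] D} {A : Bool → Subalgebra ℂ S}

theorem IsAlternatingCentred.tail {p : Bool × S} {w : List (Bool × S)}
    (h : IsAlternatingCentred e A (p :: w)) : IsAlternatingCentred e A w :=
  ⟨h.chain.tail, fun q hq => h.mem q (List.mem_cons_of_mem _ hq),
    fun q hq => h.centred q (List.mem_cons_of_mem _ hq)⟩

theorem IsAlternatingCentred.replace_head {b : Bool} {s t : S} {w : List (Bool × S)}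
    (h : IsAlternatingCentred e A ((b, s) :: w)) (ht : t ∈ A b) (het : e t = 0) :
    IsAlternatingCentred e A ((b, t) :: w) := by
  refine ⟨?_, ?_, ?_⟩
  · have hc := h.chain
    rw [List.isChain_cons] at hc ⊢
    exact hc
  · intro p hp
    rcases List.mem_cons.1 hp with rfl | hp
    · exact ht
    · exact h.mem p (List.mem_cons_of_mem _ hp)
  · intro p hp
    rcases List.mem_cons.1 hp with rfl | hp
    · exact het
    · exact h.centred p (List.mem_cons_of_mem _ hp)

theorem IsAlternatingCentred.singleton {b : Bool} {t : S} (ht : t ∈ A b) (het : e t = 0) :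
    IsAlternatingCentred e A [(b, t)] :=
  ⟨List.isChain_singleton _, by simpa using ht, by simpa using het⟩

theorem IsAlternatingCentred.cons {b c : Bool} {s t : S} {w : List (Bool × S)}
    (h : IsAlternatingCentred e A ((c, s) :: w)) (hbc : b ≠ c) (ht : t ∈ A b) (het : e t = 0) :
    IsAlternatingCentred e A ((b, t) :: (c, s) :: w) := by
  refine ⟨List.isChain_cons_cons.2 ⟨hbc, h.chain⟩, ?_, ?_⟩
  · intro p hp
    rcases List.mem_cons.1 hp with rfl | hp
    · exact ht
    · exact h.mem p hp
  · intro p hp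
    rcases List.mem_cons.1 hp with rfl | hp
    · exact het
    · exact h.centred p hp

/-- If `A false` and `A true` generate `S` then `S` is spanned by the amalgam `D` and the
alternating centred words. -/
theorem span_alternatingCentred (δ : D →ₐ[ℂ] S) (heδ : ∀ d, e (δ d) = d)
    (hl : ∀ d s, e (δ d * s) = d * e s) (hr : ∀ s d, e (s * δ d) = e s * d)
    (hδ : ∀ b d, δ d ∈ A b) (hA : A false ⊔ A true = ⊤) :
    Submodule.span ℂ (Set.range δ ∪ {s | ∃ w : List (Bool × S), w ≠ [] ∧
      IsAlternatingCentred e A w ∧ s = (w.map Prod.snd).prod}) = ⊤ := by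
  set G : Set S := Set.range δ ∪ {s | ∃ w : List (Bool × S), w ≠ [] ∧
      IsAlternatingCentred e A w ∧ s = (w.map Prod.snd).prod} with hG
  set V := Submodule.span ℂ G
  -- An element of `D` is absorbed by the first letter, which stays centred because `e` is
  -- `D`-linear.
  have hD : ∀ d w, IsAlternatingCentred e A w → δ d * (w.map Prod.snd).prod ∈ V := by
    rintro d w hw
    match w, hw with
    | [], _ => exact Submodule.subset_span (Or.inl ⟨d, by simp⟩)
    | (b, s) :: w, hw =>
      refine Submodule.subset_span (Or.inr ⟨(b, δ d * s) :: w, by simp, ?_, by simp [mul_assoc]⟩)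
      refine hw.replace_head (mul_mem (hδ b d) (hw.mem _ List.mem_cons_self)) ?_
      rw [hl, hw.centred (b, s) List.mem_cons_self, mul_zero]
  -- left multiplication by a centred letter
  have hC : ∀ b s, s ∈ A b → e s = 0 → ∀ v ∈ G, s * v ∈ V := by
    rintro b s hs hes v (⟨d, rfl⟩ | ⟨w, hw0, hw, rfl⟩)
    · refine Submodule.subset_span (Or.inr ⟨[(b, s * δ d)], by simp, ?_, by simp⟩)
      exact .singleton (mul_mem hs (hδ b d)) (by rw [hr, hes, zero_mul])
    · match w, hw0, hw with
      | (c, t) :: w, _, hw =>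
        by_cases hbc : b = c
        · subst hbc
          have hst : s * t ∈ A b := mul_mem hs (hw.mem _ List.mem_cons_self)
          -- Two adjacent letters of one factor merge; the centred part of `s * t` gives a word
          -- again, and its expectation multiplies the shorter word `w`.
          have h1 : s * ((List.map Prod.snd ((b, t) :: w)).prod)
              = (List.map Prod.snd ((b, s * t - δ (e (s * t))) :: w)).prod
                + δ (e (s * t)) * (w.map Prod.snd).prod := by
            simp [sub_mul, mul_assoc]
          rw [h1]
          refine add_mem (Submodule.subset_span (Or.inr ⟨_, by simp, ?_, rfl⟩)) (hD _ _ hw.tail)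
          exact hw.replace_head (sub_mem hst (hδ b _)) (by rw [map_sub, heδ, sub_self])
        · exact Submodule.subset_span (Or.inr ⟨(b, s) :: (c, t) :: w, by simp,
            hw.cons hbc hs hes, by simp⟩)
  have hDG : ∀ d, ∀ v ∈ G, δ d * v ∈ V := by
    rintro d v (⟨d', rfl⟩ | ⟨w, -, hw, rfl⟩)
    · exact Submodule.subset_span (Or.inl ⟨d * d', by simp⟩)
    · exact hD d w hw
  have hL : ∀ b s, s ∈ A b → ∀ v ∈ V, s * v ∈ V := by
    intro b s hs v hv
    induction hv using Submodule.span_induction with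
    | mem v hv =>
      have h1 : s * v = (s - δ (e s)) * v + δ (e s) * v := by rw [sub_mul, sub_add_cancel]
      rw [h1]
      exact add_mem (hC b _ (sub_mem hs (hδ b _)) (by rw [map_sub, heδ, sub_self]) v hv)
        (hDG _ v hv)
    | zero => simp
    | add x y _ _ hx hy => rw [mul_add]; exact add_mem hx hy
    | smul c x _ hx => rw [mul_smul_comm]; exact V.smul_mem c hx
  -- The elements that leave `V` stable under left multiplication form a subalgebra. It contains
  -- both factors, hence everything, and applying it to `1 ∈ V` gives `V = ⊤`.
  let T : Subalgebra ℂ S :=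
    { carrier := {s | ∀ v ∈ V, s * v ∈ V}
      mul_mem' := fun {a b} ha hb v hv => by rw [mul_assoc]; exact ha _ (hb v hv)
      add_mem' := fun {a b} ha hb v hv => by rw [add_mul]; exact add_mem (ha v hv) (hb v hv)
      algebraMap_mem' := fun c v hv => by
        rw [← Algebra.smul_def]; exact V.smul_mem c hv }
  have hT : (⊤ : Subalgebra ℂ S) ≤ T := hA ▸ sup_le (hL false) (hL true)
  have h1 : (1 : S) ∈ V := Submodule.subset_span (Or.inl ⟨1, map_one δ⟩)
  refine eq_top_iff.2 fun s _ => ?_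
  simpa using hT (Algebra.mem_top (x := s)) 1 h1

end Words

/-! ### Free difference quotients under homomorphisms -/

namespace NCPoly

variable {R S I J : Type*} [Ring R] [Algebra ℂ R] [Ring S] [Algebra ℂ S]
  [DecidableEq J]

/-- Both sides obey the same Leibniz rule along `φ`, so agreement on the generators suffices. -/
theorem diff_algHom [DecidableEq I] (φ : NCPoly R I →ₐ[ℂ] NCPoly S J) (i : I) (j : J)
    (hcoeff : ∀ a, diff j (φ (coeff a)) = 0)
    (hvar : ∀ k, diff j (φ (var k)) = if k = i then 1 ⊗ₜ 1 else 0) (p : NCPoly R I) :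
    diff j (φ p) = Algebra.TensorProduct.map φ φ (diff i p) := by
  induction p using NCPoly.induction with
  | hcoeff a => rw [hcoeff, diff_coeff, map_zero]
  | hvar k => rw [hvar, diff_var]; split_ifs <;> simp
  | hadd p q hp hq => rw [map_add, map_add, map_add, map_add, hp, hq]
  | hmul p q hp hq =>
    rw [map_mul, diff_mul, diff_mul, hp, hq, map_add, map_mul, map_mul]
    simp

theorem diff_algHom_eq_zero (φ : NCPoly R I →ₐ[ℂ] NCPoly S J) (j : J)
    (hcoeff : ∀ a, diff j (φ (coeff a)) = 0)
    (hvar : ∀ k, diff j (φ (var k)) = 0) (p : NCPoly R I) : diff j (φ p) = 0 := by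
  induction p using NCPoly.induction with
  | hcoeff a => exact hcoeff a
  | hvar k => exact hvar k
  | hadd p q hp hq => rw [map_add, map_add, hp, hq, add_zero]
  | hmul p q hp hq => rw [map_mul, diff_mul, hp, hq, zero_mul, mul_zero, add_zero]

/-- The Leibniz rule for a product of several factors. -/
theorem diff_list_prod_mem (j : J) (Z : Submodule ℂ (NCPoly S J ⊗[ℂ] NCPoly S J))
    (w u : List (NCPoly S J))
    (h : ∀ l x r, w = l ++ x :: r →
      ((u.prod * l.prod) ⊗ₜ 1) * diff j x * (1 ⊗ₜ r.prod) ∈ Z) :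
    (u.prod ⊗ₜ 1) * diff j w.prod ∈ Z := by
  -- `u` collects the letters already passed by the derivation, so it has to vary in the induction.
  induction w generalizing u with
  | nil =>
    have h1 : diff j (1 : NCPoly S J) = 0 := by
      rw [← map_one (coeff : S →ₐ[ℂ] NCPoly S J), diff_coeff]
    simp [h1]
  | cons y w ih =>
    rw [List.prod_cons, diff_mul, mul_add]
    refine add_mem ?_ ?_
    · have := h [] y w rfl
      simpa [mul_assoc] using this
    · have := ih (u ++ [y]) fun l x r hw => by
        have := h (y :: l) x r (by simp [hw])
        simpa [mul_assoc] using this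
      simpa [← mul_assoc] using this

theorem algHom_ext {T : Type*} [Semiring T] [Algebra ℂ T] {f g : NCPoly R I →ₐ[ℂ] T}
    (hcoeff : ∀ a, f (coeff a) = g (coeff a)) (hvar : ∀ i, f (var i) = g (var i)) : f = g := by
  refine AlgHom.ext fun p => ?_
  induction p using NCPoly.induction with
  | hcoeff a => exact hcoeff a
  | hvar k => exact hvar k
  | hadd p q hp hq => rw [map_add, map_add, hp, hq]
  | hmul p q hp hq => rw [map_mul, map_mul, hp, hq]

end NCPoly

/-! ### Rows of free Stein kernels -/

section Evaluation

variable {M : Type u} [CStarAlgebra M] {I K : Type*}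

theorem evTuple_mem (B : StarSubalgebra ℂ M) (X : I → M) (p : NCPoly B I) :
    evTuple B X p ∈ adjoinTuple B X := by
  induction p using NCPoly.induction with
  | hcoeff a =>
    simp only [evTuple, NCPoly.lift_coeff]
    exact (le_sup_left : B ≤ adjoinTuple B X) a.2
  | hvar i =>
    simp only [evTuple, NCPoly.lift_var]
    exact (le_sup_right : _ ≤ adjoinTuple B X)
      (StarAlgebra.subset_adjoin ℂ _ (Set.mem_range_self i))
  | hadd p q hp hq => rw [map_add]; exact add_mem hp hq
  | hmul p q hp hq => rw [map_mul]; exact mul_mem hp hq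

theorem le_adjoinTuple (B : StarSubalgebra ℂ M) (X : I → M) : B ≤ adjoinTuple B X :=
  le_sup_left

theorem apply_mem_adjoinTuple (B : StarSubalgebra ℂ M) (X : I → M) (i : I) :
    X i ∈ adjoinTuple B X :=
  (le_sup_right : _ ≤ adjoinTuple B X) (StarAlgebra.subset_adjoin ℂ _ (Set.mem_range_self i))

theorem adjoinTuple_le {B S : StarSubalgebra ℂ M} {X : I → M} (hB : B ≤ S) (hX : ∀ i, X i ∈ S) :
    adjoinTuple B X ≤ S :=
  sup_le hB (StarAlgebra.adjoin_le (by rintro _ ⟨i, rfl⟩; exact hX i))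

/-- The change of coefficients and variables `B⟨T_I⟩ → B'⟨T_K⟩` for `B ≤ B'`. -/
noncomputable def substHom {B B' : StarSubalgebra ℂ M} (h : B ≤ B') (v : I → NCPoly B' K) :
    NCPoly B I →ₐ[ℂ] NCPoly B' K :=
  NCPoly.lift (NCPoly.coeff.comp (StarSubalgebra.inclusion h).toAlgHom) v

theorem substHom_coeff {B B' : StarSubalgebra ℂ M} (h : B ≤ B') (v : I → NCPoly B' K) (a : B) :
    substHom h v (NCPoly.coeff a) = NCPoly.coeff ⟨a, h a.2⟩ := by
  simp [substHom]; rfl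

theorem substHom_var {B B' : StarSubalgebra ℂ M} (h : B ≤ B') (v : I → NCPoly B' K) (i : I) :
    substHom h v (NCPoly.var i) = v i := by
  simp [substHom]

theorem evTuple_substHom {B B' : StarSubalgebra ℂ M} (h : B ≤ B') {v : I → NCPoly B' K}
    {X : I → M} {Z : K → M} (hv : ∀ i, evTuple B' Z (v i) = X i) (p : NCPoly B I) :
    evTuple B' Z (substHom h v p) = evTuple B X p := by
  have : (evTuple B' Z).comp (substHom h v) = evTuple B X := by
    refine NCPoly.algHom_ext (fun a => ?_) (fun i => ?_)
    · rw [AlgHom.comp_apply, substHom_coeff]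
      simp [evTuple]
    · rw [AlgHom.comp_apply, substHom_var, hv]
      simp [evTuple]
  exact DFunLike.congr_fun this p

theorem map_evTuple_substHom {B B' : StarSubalgebra ℂ M} (h : B ≤ B') {v : I → NCPoly B' K}
    {X : I → M} {Z : K → M} (hv : ∀ i, evTuple B' Z (v i) = X i)
    (t : NCPoly B I ⊗[ℂ] NCPoly B I) :
    TensorProduct.map (evTuple B' Z).toLinearMap (evTuple B' Z).toLinearMap
      (Algebra.TensorProduct.map (substHom h v) (substHom h v) t) =
    TensorProduct.map (evTuple B X).toLinearMap (evTuple B X).toLinearMap t := by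
  induction t using TensorProduct.induction_on with
  | zero => simp
  | tmul x y => simp [evTuple_substHom h hv]
  | add x y hx hy => simp only [map_add, hx, hy]

end Evaluation

section Rows

variable {M : Type u} [CStarAlgebra M] [PartialOrder M] [StarOrderedRing M]

/-- The tensor `ev_X (∂ k P)` in `L²(M ⊗ M°)`. -/
noncomputable def evDiff {I : Type*} [DecidableEq I] (τ : M →ₚ[ℂ] ℂ) (B : StarSubalgebra ℂ M)
    (X : I → M) (k : I) : NCPoly B I →ₗ[ℂ] L2Tensor τ :=
  tensorToL2 τ ∘ₗ TensorProduct.map (evTuple B X).toLinearMap (evTuple B X).toLinearMap ∘ₗ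
    NCPoly.diff k

/-- `a` is a row of a free Stein kernel, belonging to the component `ξ`. -/
structure IsSteinRow {I : Type*} [Fintype I] [DecidableEq I] (τ : M →ₚ[ℂ] ℂ) (X : I → M)
    (B : StarSubalgebra ℂ M) (ξ : τ.GNS) (a : I → L2Tensor τ) : Prop where
  entry_mem : ∀ k, a k ∈ L2TensorOf τ (adjoinTuple B X)
  inner_eq : ∀ p : NCPoly B I,
    inner ℂ ξ (toL2 τ (evTuple B X p)) = ∑ k, inner ℂ (a k) (evDiff τ B X k p)

variable {τ : M →ₚ[ℂ] ℂ}

/-- This carries the test identity along a change of coefficients and variables; it serves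
restriction, extension and enlargement of the coefficients alike. -/
theorem evDiff_substHom {I K : Type*} [DecidableEq I] [DecidableEq K] {B B' : StarSubalgebra ℂ M}
    (h : B ≤ B') {v : I → NCPoly B' K} {X : I → M} {Z : K → M}
    (hv : ∀ i, evTuple B' Z (v i) = X i) {i : I} {j : K}
    (hd : ∀ l, NCPoly.diff j (v l) = if l = i then 1 ⊗ₜ 1 else 0) (p : NCPoly B I) :
    evDiff τ B' Z j (substHom h v p) = evDiff τ B X i p := by
  rw [evDiff, LinearMap.comp_apply, LinearMap.comp_apply, NCPoly.diff_algHom _ i,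
    map_evTuple_substHom h hv]
  · rfl
  · intro a; rw [substHom_coeff, NCPoly.diff_coeff]
  · intro k; rw [substHom_var, hd]

theorem tensorToL2_map_evTuple_mem (B : StarSubalgebra ℂ M) {I : Type*} (X : I → M)
    (t : NCPoly B I ⊗[ℂ] NCPoly B I) :
    tensorToL2 τ (TensorProduct.map (evTuple B X).toLinearMap (evTuple B X).toLinearMap t) ∈
      L2TensorOf τ (adjoinTuple B X) := by
  induction t using TensorProduct.induction_on with
  | zero => simp
  | tmul x y =>
    exact Submodule.le_topologicalClosure _ (Submodule.subset_span
      ⟨_, evTuple_mem B X x, _, evTuple_mem B X y, by simp⟩)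
  | add x y hx hy => simp only [map_add]; exact add_mem hx hy

variable {I K : Type*} [Fintype I] [DecidableEq I] [Fintype K] [DecidableEq K]

/-- The components of `P` are arbitrary and independent, so testing on a `P` supported in one
component isolates one row. -/
theorem isFreeSteinKernel_iff {X : I → M} {B : StarSubalgebra ℂ M} {Ξ : I → τ.GNS}
    {A : Matrix I I (L2Tensor τ)} :
    IsFreeSteinKernel τ X B Ξ A ↔ ∀ j, IsSteinRow τ X B (Ξ j) (A j) := by
  constructor
  · refine fun h j => ⟨h.entry_mem j, fun p => ?_⟩
    have := h.inner_eq (Pi.single j p)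
    rw [Finset.sum_eq_single j, hsInner, Finset.sum_eq_single j] at this
    · simpa [evJacobian, evDiff] using this
    · intro i _ hij
      simp [evJacobian, Pi.single_eq_of_ne hij]
    · simp
    · intro i _ hij
      simp [Pi.single_eq_of_ne hij]
    · simp
  · exact fun h => ⟨fun j k => (h j).entry_mem k,
      fun P => Finset.sum_congr rfl fun j _ => (h j).inner_eq (P j)⟩

/-- The projection of `L²(M ⊗ M°)` onto `L²(A ⊗ A°)`. -/
noncomputable def projL2Tensor (τ : M →ₚ[ℂ] ℂ) (A : StarSubalgebra ℂ M) :
    L2Tensor τ →L[ℂ] L2Tensor τ :=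
  haveI : CompleteSpace (L2TensorOf τ A) :=
    (Submodule.isClosed_topologicalClosure _).completeSpace_coe
  (L2TensorOf τ A).starProjection

theorem projL2Tensor_mem (A : StarSubalgebra ℂ M) (x : L2Tensor τ) :
    projL2Tensor τ A x ∈ L2TensorOf τ A :=
  haveI : CompleteSpace (L2TensorOf τ A) :=
    (Submodule.isClosed_topologicalClosure _).completeSpace_coe
  Submodule.starProjection_apply_mem _ _

theorem projL2Tensor_eq_self {A : StarSubalgebra ℂ M} {x : L2Tensor τ}
    (hx : x ∈ L2TensorOf τ A) : projL2Tensor τ A x = x :=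
  haveI : CompleteSpace (L2TensorOf τ A) :=
    (Submodule.isClosed_topologicalClosure _).completeSpace_coe
  Submodule.starProjection_eq_self_iff.2 hx

/-- The projection is self-adjoint and fixes `y`; hence projecting the entries of a row is invisible
to test tensors in the subspace. -/
theorem inner_projL2Tensor {A : StarSubalgebra ℂ M} {y : L2Tensor τ}
    (hy : y ∈ L2TensorOf τ A) (x : L2Tensor τ) :
    inner ℂ (projL2Tensor τ A x) y = inner ℂ x y := by
  have : CompleteSpace (L2TensorOf τ A) :=
    (Submodule.isClosed_topologicalClosure _).completeSpace_coe
  have h := Submodule.inner_starProjection_left_eq_right (L2TensorOf τ A) x y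
  rw [Submodule.starProjection_eq_self_iff.2 hy] at h
  exact h

theorem norm_projL2Tensor_le (A : StarSubalgebra ℂ M) (x : L2Tensor τ) :
    ‖projL2Tensor τ A x‖ ≤ ‖x‖ :=
  haveI : CompleteSpace (L2TensorOf τ A) :=
    (Submodule.isClosed_topologicalClosure _).completeSpace_coe
  Submodule.norm_starProjection_apply_le _ _

/-- Restriction of a row to some of the variables and to a smaller coefficient algebra. -/
theorem IsSteinRow.restrict {B B' : StarSubalgebra ℂ M} (hB : B ≤ B') {X : I → M} {Z : K → M}
    {ι : I → K} (hι : Function.Injective ι) (hZ : ∀ i, Z (ι i) = X i) {ξ : τ.GNS}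
    {a : K → L2Tensor τ} (h : IsSteinRow τ Z B' ξ a) :
    IsSteinRow τ X B ξ fun i => projL2Tensor τ (adjoinTuple B X) (a (ι i)) := by
  refine ⟨fun k => projL2Tensor_mem _ _, fun p => ?_⟩
  have hv : ∀ i, evTuple B' Z (NCPoly.var (ι i)) = X i := fun i => by simp [evTuple, hZ]
  have h1 := h.inner_eq (substHom hB (fun i => NCPoly.var (ι i)) p)
  rw [evTuple_substHom hB hv] at h1
  rw [h1]
  symm
  -- Variables outside the range of `ι` do not occur in the substituted polynomial, so their
  -- derivatives vanish.
  refine Fintype.sum_of_injective ι hι _ _ (fun k hk => ?_) (fun i => ?_)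
  · rw [evDiff, LinearMap.comp_apply, LinearMap.comp_apply, NCPoly.diff_algHom_eq_zero]
    · simp
    · intro a; simp [substHom_coeff]
    · intro i
      rw [substHom_var, NCPoly.diff_var, if_neg]
      exact fun hi => hk ⟨i, hi⟩
  · have hmem : evDiff τ B X i p ∈ L2TensorOf τ (adjoinTuple B X) :=
      tensorToL2_map_evTuple_mem B X _
    rw [inner_projL2Tensor hmem]
    rw [evDiff_substHom hB hv (i := i)]
    intro l
    simp [hι.eq_iff]

/-- Extension of a row by zero to further variables, which before belonged to the coefficient
algebra. -/
theorem IsSteinRow.extend {B B' : StarSubalgebra ℂ M} (hB : B ≤ B') {X : I → M} {Z : K → M}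
    (hle : adjoinTuple B' X ≤ adjoinTuple B Z) {ι : I → K} (hι : Function.Injective ι)
    {v : K → NCPoly B' I} (hv : ∀ k, evTuple B' X (v k) = Z k)
    (hd : ∀ k i, NCPoly.diff i (v k) = if k = ι i then 1 ⊗ₜ 1 else 0) {ξ : τ.GNS}
    {a : I → L2Tensor τ} (h : IsSteinRow τ X B' ξ a) {a' : K → L2Tensor τ}
    (ha : ∀ i, a' (ι i) = a i) (ha0 : ∀ k, k ∉ Set.range ι → a' k = 0) :
    IsSteinRow τ Z B ξ a' := by
  have hmono : L2TensorOf τ (adjoinTuple B' X) ≤ L2TensorOf τ (adjoinTuple B Z) := by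
    refine Submodule.topologicalClosure_mono (Submodule.span_mono ?_)
    rintro _ ⟨x, hx, y, hy, rfl⟩
    exact ⟨x, hle hx, y, hle hy, rfl⟩
  refine ⟨fun k => ?_, fun p => ?_⟩
  · by_cases hk : k ∈ Set.range ι
    · obtain ⟨i, rfl⟩ := hk
      rw [ha]
      exact hmono (h.entry_mem i)
    · rw [ha0 k hk]
      exact zero_mem _
  -- The variables outside the range of `ι` are to be read as coefficients; the row for `X` is
  -- tested on the polynomial so rewritten.
  · have h1 := h.inner_eq (substHom hB v p)
    rw [evTuple_substHom hB hv] at h1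
    rw [h1]
    refine Fintype.sum_of_injective ι hι _ _ (fun k hk => ?_) (fun i => ?_)
    · rw [ha0 k hk, inner_zero_left]
    · rw [ha, evDiff_substHom hB hv (i := ι i) (hd · i)]

end Rows

/-! ### Rows and freeness with amalgamation -/

section Free

variable {M : Type u} [CStarAlgebra M] [PartialOrder M] [StarOrderedRing M] {τ : M →ₚ[ℂ] ℂ}
  {N D : StarSubalgebra ℂ M} {E : N →ₗ[ℂ] D}

/-- The subalgebra `A₁ ∩ N` (label `false`) or `A₂ ∩ N` (label `true`) of `N`. -/
def freeFactor (N A₁ A₂ : StarSubalgebra ℂ M) (b : Bool) : Subalgebra ℂ N :=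
  (if b then A₂ else A₁).toSubalgebra.comap N.subtype.toAlgHom

omit [PartialOrder M] [StarOrderedRing M] in
theorem mem_freeFactor {N A₁ A₂ : StarSubalgebra ℂ M} {b : Bool} {x : N} :
    x ∈ freeFactor N A₁ A₂ b ↔ (x : M) ∈ (if b then A₂ else A₁) := Iff.rfl

namespace IsTracePreservingCondExp

omit [StarOrderedRing M] in
theorem map_mul_left (hE : IsTracePreservingCondExp τ N D E) (d : D) (x : N) :
    E (⟨d, hE.le d.2⟩ * x) = d * E x := by
  have := hE.bimodule ⟨d, hE.le d.2⟩ x 1 d.2 (one_mem D)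
  exact Subtype.ext (by simpa using this)

omit [StarOrderedRing M] in
theorem map_mul_right (hE : IsTracePreservingCondExp τ N D E) (d : D) (x : N) :
    E (x * ⟨d, hE.le d.2⟩) = E x * d := by
  have := hE.bimodule 1 x ⟨d, hE.le d.2⟩ (one_mem D) d.2
  exact Subtype.ext (by simpa using this)

omit [StarOrderedRing M] in
theorem map_coe (hE : IsTracePreservingCondExp τ N D E) (d : D) : E ⟨d, hE.le d.2⟩ = d :=
  Subtype.ext (hE.map_of_mem _ d.2)

end IsTracePreservingCondExp

variable {A₁ A₂ : StarSubalgebra ℂ M}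

omit [StarOrderedRing M] in
/-- An alternating centred word with a letter in `A₂` is orthogonal to `A₁`. -/
theorem IsFreeWithAmalgamation.condExp_mul_word (hE : IsTracePreservingCondExp τ N D E)
    (hF : IsFreeWithAmalgamation E A₁ A₂) {w : List (Bool × N)}
    (hw : IsAlternatingCentred E (freeFactor N A₁ A₂) w) (ht : ∃ p ∈ w, p.1 = true) {a : N}
    (ha : (a : M) ∈ A₁) : E (a * (w.map Prod.snd).prod) = 0 := by
  have halt : ∀ v : List (Bool × N), v ≠ [] → IsAlternatingCentred E (freeFactor N A₁ A₂) v →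
      E (v.map Prod.snd).prod = 0 := fun v hv0 hv =>
    hF.alternating v hv0 hv.chain fun p hp => ⟨mem_freeFactor.1 (hv.mem p hp), hv.centred p hp⟩
  -- For a word starting in `A₂`, the letter `a - E a` in front keeps it alternating and centred,
  -- while the correction is `E a` times the expectation of the word itself, again zero.
  have key : ∀ (s : N) (v : List (Bool × N)) (a : N), (a : M) ∈ A₁ →
      IsAlternatingCentred E (freeFactor N A₁ A₂) ((true, s) :: v) →
      E (a * (((true, s) :: v).map Prod.snd).prod) = 0 := by
    intro s v a ha hv
    have hEa : ((E a : D) : M) ∈ A₁ := hF.le_left (E a).2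
    have h1 : IsAlternatingCentred E (freeFactor N A₁ A₂)
        ((false, a - ⟨E a, hE.le (E a).2⟩) :: (true, s) :: v) :=
      hv.cons (by simp) (mem_freeFactor.2 (sub_mem ha hEa)) (by rw [map_sub, hE.map_coe, sub_self])
    have h2 := halt _ (by simp) h1
    have h3 := halt _ (by simp) hv
    rw [List.map_cons, List.prod_cons, sub_mul, map_sub, hE.map_mul_left, h3, mul_zero,
      sub_zero] at h2
    exact h2
  match w, hw, ht with
  | (true, s) :: v, hw, _ => exact key s v a ha hw
  | (false, s) :: [], _, ht => simp at ht
  | (false, s) :: (false, t) :: v, hw, _ => simpa using hw.chain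
  -- A leading `A₁` letter is absorbed into `a`.
  | (false, s) :: (true, t) :: v, hw, _ =>
    have h := key t v (a * s) (mul_mem ha (mem_freeFactor.1 (hw.mem (false, s) (by simp)))) hw.tail
    simpa [mul_assoc] using h

/-- `L²(A)` as a closed subspace of `L²(M)`. -/
noncomputable def L2Of (τ : M →ₚ[ℂ] ℂ) (A : StarSubalgebra ℂ M) : Submodule ℂ τ.GNS :=
  (A.toSubalgebra.toSubmodule.map (toL2 τ)).topologicalClosure

theorem mem_orthogonal_L2Of {A : StarSubalgebra ℂ M} {x : M}
    (h : ∀ a ∈ A, τ (a * x) = 0) : toL2 τ x ∈ (L2Of τ A)ᗮ := by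
  have : L2Of τ A ≤ (Submodule.span ℂ {toL2 τ x})ᗮ := by
    refine Submodule.topologicalClosure_minimal _ ?_ (Submodule.isClosed_orthogonal _)
    rintro _ ⟨a, ha, rfl⟩
    rw [Submodule.mem_orthogonal_singleton_iff_inner_left, inner_toL2]
    exact h _ (star_mem ha)
  intro y hy
  exact Submodule.mem_orthogonal_singleton_iff_inner_left.1 (this hy)

theorem mem_orthogonal_L2TensorOf {A : StarSubalgebra ℂ M} {z : L2Tensor τ}
    (h : ∀ a ∈ A, ∀ b ∈ A, inner ℂ (tensorToL2 τ (a ⊗ₜ b)) z = 0) :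
    z ∈ (L2TensorOf τ A)ᗮ := by
  have : L2TensorOf τ A ≤ (Submodule.span ℂ {z})ᗮ := by
    refine Submodule.topologicalClosure_minimal _ ?_ (Submodule.isClosed_orthogonal _)
    rw [Submodule.span_le]
    rintro _ ⟨a, ha, b, hb, rfl⟩
    exact Submodule.mem_orthogonal_singleton_iff_inner_left.2 (h a ha b hb)
  intro y hy
  exact Submodule.mem_orthogonal_singleton_iff_inner_left.1 (this hy)

variable {I : Type*} [Fintype I] [DecidableEq I]

/-- In a row the vector `ξ` may be replaced by its projection onto `L²(B⟨X⟩)`. -/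
theorem IsSteinRow.exists_mem_L2Of {B : StarSubalgebra ℂ M} {X : I → M} {ξ : τ.GNS}
    {a : I → L2Tensor τ} (h : IsSteinRow τ X B ξ a) :
    ∃ η ∈ L2Of τ (adjoinTuple B X), IsSteinRow τ X B η a := by
  have : CompleteSpace (L2Of τ (adjoinTuple B X)) :=
    (Submodule.isClosed_topologicalClosure _).completeSpace_coe
  refine ⟨_, Submodule.starProjection_apply_mem (L2Of τ (adjoinTuple B X)) ξ, h.entry_mem,
    fun p => ?_⟩
  have hp : toL2 τ (evTuple B X p) ∈ L2Of τ (adjoinTuple B X) :=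
    Submodule.le_topologicalClosure _ ⟨_, evTuple_mem B X p, rfl⟩
  rw [Submodule.inner_starProjection_left_eq_right, Submodule.starProjection_eq_self_iff.2 hp]
  exact h.inner_eq p

/-- The evaluation with values in a subalgebra containing the coefficients and the tuple. -/
noncomputable def evInto {R N : StarSubalgebra ℂ M} {X : I → M} (h : adjoinTuple R X ≤ N) :
    NCPoly R I →ₐ[ℂ] N :=
  NCPoly.lift (StarSubalgebra.inclusion ((le_adjoinTuple R X).trans h)).toAlgHom
    fun i => ⟨X i, h (apply_mem_adjoinTuple R X i)⟩

omit [PartialOrder M] [StarOrderedRing M] [Fintype I] [DecidableEq I] in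
theorem coe_evInto {R N : StarSubalgebra ℂ M} {X : I → M} (h : adjoinTuple R X ≤ N)
    (p : NCPoly R I) : (evInto h p : M) = evTuple R X p := by
  have : N.subtype.toAlgHom.comp (evInto h) = evTuple R X :=
    NCPoly.algHom_ext (fun a => by simp [evInto, evTuple]) (fun i => by simp [evInto, evTuple])
  exact DFunLike.congr_fun this p

/-- The subalgebras `B⟨T⟩` (label `false`) and `A₂` (label `true`) of `R⟨T⟩`. -/
noncomputable def polyFactor (I : Type*) {B R : StarSubalgebra ℂ M} (hB : B ≤ R)
    (A₂ : StarSubalgebra ℂ M) (b : Bool) : Subalgebra ℂ (NCPoly R I) :=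
  if b then (A₂.toSubalgebra.comap R.subtype.toAlgHom).map NCPoly.coeff
  else (substHom hB (NCPoly.var : I → NCPoly R I)).range

-- The indeterminates and the coefficients from `B` lie in the first factor, and `R` is generated by
-- `B` and `A₂`.
omit [PartialOrder M] [StarOrderedRing M] [Fintype I] [DecidableEq I] in
theorem polyFactor_sup {B R : StarSubalgebra ℂ M} (hB : B ≤ R) (hA : A₂ ≤ R) (hR : R ≤ B ⊔ A₂) :
    polyFactor I hB A₂ false ⊔ polyFactor I hB A₂ true = ⊤ := by
  set T := polyFactor I hB A₂ false ⊔ polyFactor I hB A₂ true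
  have hTB : ∀ (x : M) (hx : x ∈ B), (NCPoly.coeff ⟨x, hB hx⟩ : NCPoly R I) ∈ T := fun x hx =>
    (le_sup_left : polyFactor I hB A₂ false ≤ T)
      ⟨NCPoly.coeff ⟨x, hx⟩, substHom_coeff hB _ ⟨x, hx⟩⟩
  have hTA : ∀ (x : M) (hx : x ∈ A₂), (NCPoly.coeff ⟨x, hA hx⟩ : NCPoly R I) ∈ T := fun x hx =>
    (le_sup_right : polyFactor I hB A₂ true ≤ T) ⟨⟨x, hA hx⟩, hx, rfl⟩
  -- The join `B ⊔ A₂` is one of `*`-subalgebras, whereas `R⟨T⟩` is not given an involution here;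
  -- `Q` therefore asks for both `x` and `star x`.
  let Q : StarSubalgebra ℂ M :=
    { carrier := {x | ∃ h : x ∈ R, (NCPoly.coeff ⟨x, h⟩ : NCPoly R I) ∈ T ∧
        (NCPoly.coeff ⟨star x, star_mem h⟩ : NCPoly R I) ∈ T}
      mul_mem' := by
        rintro x y ⟨hx, hx1, hx2⟩ ⟨hy, hy1, hy2⟩
        refine ⟨mul_mem hx hy, ?_, ?_⟩
        · have := mul_mem hx1 hy1
          rwa [← map_mul] at this
        · have := mul_mem hy2 hx2
          rw [← map_mul] at this
          simp only [star_mul]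
          exact this
      add_mem' := by
        rintro x y ⟨hx, hx1, hx2⟩ ⟨hy, hy1, hy2⟩
        refine ⟨add_mem hx hy, ?_, ?_⟩
        · have := add_mem hx1 hy1
          rwa [← map_add] at this
        · have := add_mem hx2 hy2
          rw [← map_add] at this
          simp only [star_add]
          exact this
      algebraMap_mem' := fun c => ⟨algebraMap_mem R c, hTB _ (algebraMap_mem B c),
        hTB _ (star_mem (algebraMap_mem B c))⟩
      star_mem' := by
        rintro x ⟨hx, hx1, hx2⟩
        exact ⟨star_mem hx, hx2, by simpa only [star_star] using hx1⟩ }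
  have hQ : R ≤ Q := hR.trans (sup_le (fun x hx => ⟨hB hx, hTB x hx, hTB _ (star_mem hx)⟩)
    (fun x hx => ⟨hA hx, hTA x hx, hTA _ (star_mem hx)⟩))
  refine eq_top_iff.2 fun p _ => ?_
  induction p using NCPoly.induction with
  | hcoeff a => exact (hQ a.2).2.1
  | hvar i =>
    exact (le_sup_left : polyFactor I hB A₂ false ≤ T) ⟨NCPoly.var i, substHom_var hB _ i⟩
  | hadd p q hp hq => exact add_mem (hp trivial) (hq trivial)
  | hmul p q hp hq => exact mul_mem (hp trivial) (hq trivial)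

omit [PartialOrder M] [StarOrderedRing M] [Fintype I] [DecidableEq I] in
theorem evInto_mem_freeFactor {B R : StarSubalgebra ℂ M} (hB : B ≤ R) {X : I → M}
    (h : adjoinTuple R X ≤ N) {b : Bool} {p : NCPoly R I} (hp : p ∈ polyFactor I hB A₂ b) :
    evInto h p ∈ freeFactor N (adjoinTuple B X) A₂ b := by
  rw [mem_freeFactor, coe_evInto]
  cases b with
  | false =>
    obtain ⟨q, rfl⟩ := hp
    change evTuple R X (substHom hB _ q) ∈ adjoinTuple B X
    rw [evTuple_substHom hB (X := X) (by simp [evTuple])]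
    exact evTuple_mem B X q
  | true =>
    obtain ⟨r, hr, rfl⟩ := hp
    change evTuple R X (NCPoly.coeff r) ∈ A₂
    simpa [evTuple] using hr

/-- Under freeness the coefficient algebra of a row may be enlarged by a free factor. -/
theorem IsSteinRow.of_free {B R : StarSubalgebra ℂ M} {X : I → M}
    (hτ : ∀ x y, τ (x * y) = τ (y * x)) (hE : IsTracePreservingCondExp τ N D E)
    (hF : IsFreeWithAmalgamation E (adjoinTuple B X) A₂) (hDB : D ≤ B) (hB : B ≤ R)
    (hA : A₂ ≤ R) (hR : R ≤ B ⊔ A₂) {ξ : τ.GNS} (hξ : ξ ∈ L2Of τ (adjoinTuple B X))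
    {a : I → L2Tensor τ} (h : IsSteinRow τ X B ξ a) : IsSteinRow τ X R ξ a := by
  have hAN : adjoinTuple R X ≤ N := adjoinTuple_le
    (hR.trans (sup_le ((le_adjoinTuple B X).trans hF.left_le) hF.right_le))
    (fun i => hF.left_le (apply_mem_adjoinTuple B X i))
  have hmono : L2TensorOf τ (adjoinTuple B X) ≤ L2TensorOf τ (adjoinTuple R X) := by
    refine Submodule.topologicalClosure_mono (Submodule.span_mono ?_)
    have hle : adjoinTuple B X ≤ adjoinTuple R X := sup_le_sup_right hB _
    rintro _ ⟨x, hx, y, hy, rfl⟩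
    exact ⟨x, hle hx, y, hle hy, rfl⟩
  refine ⟨fun k => hmono (h.entry_mem k), fun p => ?_⟩
  have hv : ∀ i, evTuple R X (NCPoly.var i) = X i := fun i => by simp [evTuple]
  have hsub : ∀ q : NCPoly B I, ∀ k, evDiff τ R X k (substHom hB NCPoly.var q) =
      evDiff τ B X k q := fun q k =>
    evDiff_substHom hB hv (fun _ => NCPoly.diff_var _ _) q
  have hBT : ∀ q : NCPoly B I, inner ℂ ξ (toL2 τ (evTuple R X (substHom hB NCPoly.var q))) =
      ∑ k, inner ℂ (a k) (evDiff τ R X k (substHom hB NCPoly.var q)) := fun q => by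
    simp only [hsub, evTuple_substHom hB hv, h.inner_eq]
  let δ : D →ₐ[ℂ] NCPoly R I :=
    NCPoly.coeff.comp (StarSubalgebra.inclusion (hDB.trans hB)).toAlgHom
  have hδ : ∀ d, evInto hAN (δ d) = ⟨d, hE.le d.2⟩ := fun d =>
    Subtype.ext (by rw [coe_evInto]; simp [δ, evTuple])
  -- Letters are centred after evaluation but remain polynomials, since the derivatives are defined
  -- only on `R⟨T⟩`.
  let e : NCPoly R I →ₗ[ℂ] D := E ∘ₗ (evInto hAN).toLinearMap
  have hspan := span_alternatingCentred (e := e) (A := polyFactor I hB A₂) δ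
    (fun d => by simp [e, hδ, hE.map_coe])
    (fun d s => by simp [e, hδ, hE.map_mul_left])
    (fun s d => by simp [e, hδ, hE.map_mul_right])
    (fun b d => by
      cases b with
      | false => exact ⟨NCPoly.coeff ⟨d, hDB d.2⟩, substHom_coeff hB _ _⟩
      | true => exact ⟨⟨d, hB (hDB d.2)⟩, hF.le_right d.2, rfl⟩)
    (polyFactor_sup hB hA hR)
  -- orthogonality of words to `B⟨X⟩`
  have horth : ∀ w : List (Bool × NCPoly R I), IsAlternatingCentred e (polyFactor I hB A₂) w →
      (∃ p ∈ w, p.1 = true) → ∀ x ∈ adjoinTuple B X,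
      τ (x * evTuple R X (w.map Prod.snd).prod) = 0 := by
    intro w hw ht x hx
    have hw' : IsAlternatingCentred E (freeFactor N (adjoinTuple B X) A₂)
        (w.map (Prod.map id (evInto hAN))) := by
      refine ⟨?_, ?_, ?_⟩
      · rw [List.isChain_map]
        exact hw.chain
      · simp only [List.mem_map]
        rintro _ ⟨p, hp, rfl⟩
        exact evInto_mem_freeFactor hB hAN (hw.mem p hp)
      · simp only [List.mem_map]
        rintro _ ⟨p, hp, rfl⟩
        exact hw.centred p hp
    have h0 := hF.condExp_mul_word hE hw' (by
      obtain ⟨p, hp, hpt⟩ := ht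
      exact ⟨_, List.mem_map_of_mem hp, hpt⟩) (a := ⟨x, hF.left_le hx⟩) hx
    have h1 := hE.trace (⟨x, hF.left_le hx⟩ *
      ((w.map (Prod.map id (evInto hAN))).map Prod.snd).prod)
    rw [h0] at h1
    have h2 : ((w.map (Prod.map id (evInto hAN))).map Prod.snd).prod =
        evInto hAN (w.map Prod.snd).prod := by
      rw [map_list_prod, List.map_map, List.map_map]
      rfl
    rw [h2] at h1
    simpa [coe_evInto] using h1.symm
  have hp : p ∈ Submodule.span ℂ (Set.range δ ∪ {s | ∃ w : List (Bool × NCPoly R I), w ≠ [] ∧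
      IsAlternatingCentred e (polyFactor I hB A₂) w ∧ s = (w.map Prod.snd).prod}) := by
    rw [hspan]; trivial
  induction hp using Submodule.span_induction with
  | zero => simp
  | add x y _ _ hx hy => simp only [map_add, inner_add_right, hx, hy, Finset.sum_add_distrib]
  | smul c x _ hx => simp only [map_smul, inner_smul_right, hx, Finset.mul_sum]
  | mem s hs =>
    obtain ⟨d, rfl⟩ | ⟨w, hw0, hw, rfl⟩ := hs
    · have := hBT (NCPoly.coeff ⟨d, hDB d.2⟩)
      rw [substHom_coeff] at this
      exact this
    by_cases ht : ∃ p ∈ w, p.1 = true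
    · rw [mem_orthogonal_L2Of (horth w hw ht) ξ hξ]
      refine (Finset.sum_eq_zero fun k _ => ?_).symm
      -- Each Leibniz term of the derivative is shown to be orthogonal to `L²(B⟨X⟩ ⊗ B⟨X⟩°)`, where
      -- the entries of the row lie.
      have hZ := NCPoly.diff_list_prod_mem k
        ((L2TensorOf τ (adjoinTuple B X))ᗮ.comap (tensorToL2 τ ∘ₗ
          TensorProduct.map (evTuple R X).toLinearMap (evTuple R X).toLinearMap))
        (w.map Prod.snd) [] ?_
      · rw [List.prod_nil, ← Algebra.TensorProduct.one_def, one_mul] at hZ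
        exact hZ _ (h.entry_mem k)
      intro l x r hlr
      obtain ⟨l, w', rfl, rfl, hw'⟩ := List.map_eq_append_iff.1 hlr
      obtain ⟨⟨b, x⟩, r, rfl, rfl, rfl⟩ := List.map_eq_cons_iff.1 hw'
      have hxb := hw.mem (b, x) (by simp)
      cases b with
      | true =>
        obtain ⟨c, -, rfl⟩ := hxb
        have : NCPoly.diff k (NCPoly.coeff c : NCPoly R I) = 0 := NCPoly.diff_coeff k c
        simp [this]
      | false =>
        obtain ⟨q, rfl⟩ := hxb
        have hq : NCPoly.diff k (substHom hB (NCPoly.var : I → NCPoly R I) q) =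
            Algebra.TensorProduct.map (substHom hB NCPoly.var) (substHom hB NCPoly.var)
              (NCPoly.diff k q) := by
          refine NCPoly.diff_algHom _ k _ (fun a => ?_) (fun j => ?_) q
          · simp [substHom_coeff]
          · rw [substHom_var, NCPoly.diff_var]
        change _ * NCPoly.diff k (substHom hB (NCPoly.var : I → NCPoly R I) q) * _ ∈ _
        rw [hq, List.prod_nil, one_mul]
        have hl : IsAlternatingCentred e (polyFactor I hB A₂) l :=
          ⟨(List.isChain_append.1 hw.chain).1, fun p hp => hw.mem p (by simp [hp]),
            fun p hp => hw.centred p (by simp [hp])⟩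
        have hr : IsAlternatingCentred e (polyFactor I hB A₂) r :=
          ⟨(List.isChain_append.1 hw.chain).2.1.tail, fun p hp => hw.mem p (by simp [hp]),
            fun p hp => hw.centred p (by simp [hp])⟩
        -- The differentiated letter comes from `B⟨T⟩`, so the `A₂` letter lies strictly to its left
        -- or right.
        have hlr : (∃ p ∈ l, p.1 = true) ∨ ∃ p ∈ r, p.1 = true := by
          obtain ⟨p, hp, hpt⟩ := ht
          rcases List.mem_append.1 hp with hp | hp
          · exact Or.inl ⟨p, hp, hpt⟩
          · rcases List.mem_cons.1 hp with rfl | hp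
            · simp at hpt
            · exact Or.inr ⟨p, hp, hpt⟩
        generalize NCPoly.diff k q = t
        induction t using TensorProduct.induction_on with
        | zero => simp
        | add x y hx hy => rw [map_add, mul_add, add_mul]; exact add_mem hx hy
        | tmul x y =>
          refine mem_orthogonal_L2TensorOf fun c hc d hd => ?_
          simp only [LinearMap.comp_apply, Algebra.TensorProduct.map_tmul, Algebra.TensorProduct.tmul_mul_tmul, one_mul,
            mul_one, TensorProduct.map_tmul, AlgHom.toLinearMap_apply, map_mul,
            evTuple_substHom hB hv, inner_tensorToL2]
          have hx := evTuple_mem B X x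
          have hy := evTuple_mem B X y
          rcases hlr with hl' | hr'
          -- The inner product is `τ(c* l x) τ(d* y r)`. Traciality turns the first factor into `τ(x
          -- c* l)`, with `x c*` in `B⟨X⟩`.
          · rw [← mul_assoc, hτ, ← mul_assoc, horth l hl hl' _ (mul_mem hx (star_mem hc)), zero_mul]
          · rw [← mul_assoc (star d), horth r hr hr' _ (mul_mem (star_mem hd) hy), mul_zero]
    -- Without an `A₂` letter, alternation forces the word to be a single element of `B⟨T⟩`.
    · match w, hw0, hw, ht with
      | (true, s) :: v, _, _, ht => simp at ht
      | (false, s) :: (true, t) :: v, _, _, ht => simp at ht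
      | (false, s) :: (false, t) :: v, _, hw, _ => simpa using hw.chain
      | [(false, s)], _, hw, _ =>
        obtain ⟨q, rfl⟩ := hw.mem (false, s) (by simp)
        simpa using hBT q

end Free

/-! ### The squared irregularity as an infimum -/

section Irregularity

variable {M : Type u} [CStarAlgebra M] [PartialOrder M] [StarOrderedRing M] {τ : M →ₚ[ℂ] ℂ}

theorem ofReal_hsNorm_sq {I : Type*} [Fintype I] (A : Matrix I I (L2Tensor τ)) :
    ENNReal.ofReal (hsNorm A) ^ 2 = ENNReal.ofReal (∑ j, ∑ k, ‖A j k‖ ^ 2) := by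
  rw [hsNorm, ← ENNReal.ofReal_pow (Real.sqrt_nonneg _), Real.sq_sqrt]
  exact Finset.sum_nonneg fun _ _ => Finset.sum_nonneg fun _ _ => sq_nonneg _

variable {I J : Type*} [Fintype I] [DecidableEq I] [Fintype J] [DecidableEq J]

theorem freeSteinIrregularity_sq_le {X : I → M} {B : StarSubalgebra ℂ M} {Ξ : I → τ.GNS}
    {A : Matrix I I (L2Tensor τ)} (h : IsFreeSteinKernel τ X B Ξ A) :
    freeSteinIrregularity τ X B ^ 2 ≤ ENNReal.ofReal (∑ j, ∑ k, ‖A j k - hsOne τ j k‖ ^ 2) := by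
  have hsq := ofReal_hsNorm_sq (A - hsOne τ)
  simp only [Matrix.sub_apply] at hsq
  rw [← hsq]
  gcongr
  exact (iInf_le _ Ξ).trans (iInf₂_le A h)

/-- Squaring is an order isomorphism of `[0, ∞]`, so it commutes with the infimum and only sums of
squares need to be compared. -/
theorem le_freeSteinIrregularity_sq {X : I → M} {B : StarSubalgebra ℂ M} {c : ℝ≥0∞}
    (h : ∀ Ξ A, IsFreeSteinKernel τ X B Ξ A →
      c ≤ ENNReal.ofReal (∑ j, ∑ k, ‖A j k - hsOne τ j k‖ ^ 2)) :
    c ≤ freeSteinIrregularity τ X B ^ 2 := by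
  have key : ∀ y : ℝ≥0∞, c ≤ y ^ 2 ↔ (ENNReal.orderIsoRpow 2 two_pos).symm c ≤ y := fun y => by
    rw [OrderIso.symm_apply_le, ENNReal.orderIsoRpow_apply, ENNReal.rpow_two]
  rw [key]
  refine le_iInf fun Ξ => le_iInf₂ fun A hA => ?_
  rw [← key, ofReal_hsNorm_sq]
  exact h Ξ A hA

-- The entries `1 ⊗ 1` and `0` lie in the subspace, so the projection fixes them, and it is a
-- contraction.
omit [Fintype I] in
theorem norm_projL2Tensor_sub_hsOne_le (B : StarSubalgebra ℂ M) (x : L2Tensor τ) (i k : I) :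
    ‖projL2Tensor τ B x - hsOne τ i k‖ ≤ ‖x - hsOne τ i k‖ := by
  have h : hsOne τ i k ∈ L2TensorOf τ B := by
    by_cases hik : i = k
    · subst hik
      rw [hsOne, Matrix.diagonal_apply_eq]
      exact Submodule.le_topologicalClosure _
        (Submodule.subset_span ⟨1, one_mem B, 1, one_mem B, rfl⟩)
    · rw [hsOne, Matrix.diagonal_apply_ne _ hik]
      exact zero_mem _
  rw [← projL2Tensor_eq_self h, ← map_sub, projL2Tensor_eq_self h]
  exact norm_projL2Tensor_le _ _

omit [Fintype I] [Fintype J] in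
theorem hsOne_inl (i k : I) : hsOne (I := I ⊕ J) τ (Sum.inl i) (Sum.inl k) = hsOne τ i k := by
  simp [hsOne, Matrix.diagonal_apply]

omit [Fintype I] [Fintype J] in
theorem hsOne_inr (i k : J) : hsOne (I := I ⊕ J) τ (Sum.inr i) (Sum.inr k) = hsOne τ i k := by
  simp [hsOne, Matrix.diagonal_apply]

/-- Superadditivity of the squared irregularity. -/
theorem add_le_freeSteinIrregularity_sq (X : I → M) (Y : J → M) (B C : StarSubalgebra ℂ M) :
    freeSteinIrregularity τ X B ^ 2 + freeSteinIrregularity τ Y C ^ 2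
      ≤ freeSteinIrregularity τ (Sum.elim X Y) (B ⊔ C) ^ 2 := by
  refine le_freeSteinIrregularity_sq fun Ξ A hA => ?_
  rw [isFreeSteinKernel_iff] at hA
  have hX := freeSteinIrregularity_sq_le (isFreeSteinKernel_iff.2 fun j =>
    (hA (Sum.inl j)).restrict (le_sup_left : B ≤ B ⊔ C) Sum.inl_injective (X := X) fun _ => rfl)
  have hY := freeSteinIrregularity_sq_le (isFreeSteinKernel_iff.2 fun j =>
    (hA (Sum.inr j)).restrict (le_sup_right : C ≤ B ⊔ C) Sum.inr_injective (X := Y) fun _ => rfl)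
  refine (add_le_add hX hY).trans ?_
  rw [← ENNReal.ofReal_add (by positivity) (by positivity)]
  refine ENNReal.ofReal_le_ofReal ?_
  -- The off-diagonal blocks contribute nonnegative terms and are dropped.
  simp only [Fintype.sum_sum_type, hsOne_inl, hsOne_inr]
  refine add_le_add (Finset.sum_le_sum fun j _ => ?_) (Finset.sum_le_sum fun j _ => ?_)
  · refine le_trans (Finset.sum_le_sum fun k _ => ?_) (le_add_of_nonneg_right (by positivity))
    gcongr
    exact norm_projL2Tensor_sub_hsOne_le _ _ _ _
  · refine le_trans (Finset.sum_le_sum fun k _ => ?_) (le_add_of_nonneg_left (by positivity))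
    gcongr
    exact norm_projL2Tensor_sub_hsOne_le _ _ _ _

/-- The upper bound for the squared irregularity of a joint tuple. -/
theorem freeSteinIrregularity_sq_le_add (X : I → M) (Y : J → M) (B : StarSubalgebra ℂ M) :
    freeSteinIrregularity τ (Sum.elim X Y) B ^ 2
      ≤ freeSteinIrregularity τ X (adjoinTuple B Y) ^ 2
        + freeSteinIrregularity τ Y (adjoinTuple B X) ^ 2 := by
  have hXZ : ∀ i, X i ∈ adjoinTuple B (Sum.elim X Y) := fun i =>
    apply_mem_adjoinTuple B (Sum.elim X Y) (Sum.inl i)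
  have hYZ : ∀ j, Y j ∈ adjoinTuple B (Sum.elim X Y) := fun j =>
    apply_mem_adjoinTuple B (Sum.elim X Y) (Sum.inr j)
  have hB := le_adjoinTuple B (Sum.elim X Y)
  -- Truncated subtraction isolates one irregularity at a time, so each of the two infima is
  -- replaced by an arbitrary kernel in turn.
  rw [← tsub_le_iff_right]
  refine le_freeSteinIrregularity_sq fun Ξ A hA => ?_
  rw [tsub_le_iff_tsub_le]
  refine le_freeSteinIrregularity_sq fun Ξ' A' hA' => ?_
  rw [tsub_le_iff_left, ← ENNReal.ofReal_add (by positivity) (by positivity)]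
  rw [isFreeSteinKernel_iff] at hA hA'
  have hker : IsFreeSteinKernel τ (Sum.elim X Y) B (Sum.elim Ξ Ξ')
      (Matrix.fromBlocks A 0 0 A') := by
    refine isFreeSteinKernel_iff.2 ?_
    rintro (j | j)
    · refine (hA j).extend (le_adjoinTuple B Y)
        (adjoinTuple_le (adjoinTuple_le hB hYZ) hXZ) Sum.inl_injective
        (v := Sum.elim NCPoly.var
          fun j => NCPoly.coeff ⟨Y j, apply_mem_adjoinTuple B Y j⟩) ?_ ?_ ?_ ?_
      · rintro (i | i) <;> simp [evTuple]
      · rintro (i | i) k <;> simp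
      · intro i; rfl
      · rintro (i | i) hi
        · exact absurd ⟨i, rfl⟩ hi
        · rfl
    · refine (hA' j).extend (le_adjoinTuple B X)
        (adjoinTuple_le (adjoinTuple_le hB hXZ) hYZ) Sum.inr_injective
        (v := Sum.elim (fun j => NCPoly.coeff ⟨X j, apply_mem_adjoinTuple B X j⟩)
          NCPoly.var) ?_ ?_ ?_ ?_
      · rintro (i | i) <;> simp [evTuple]
      · rintro (i | i) k <;> simp
      · intro i; rfl
      · rintro (i | i) hi
        · rfl
        · exact absurd ⟨i, rfl⟩ hi
  refine (freeSteinIrregularity_sq_le hker).trans (ENNReal.ofReal_le_ofReal (le_of_eq ?_))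
  have h12 : ∀ i k, hsOne (I := I ⊕ J) τ (Sum.inl i) (Sum.inr k) = 0 := fun i k => by simp [hsOne]
  have h21 : ∀ i k, hsOne (I := I ⊕ J) τ (Sum.inr i) (Sum.inl k) = 0 := fun i k => by simp [hsOne]
  simp [Fintype.sum_sum_type, hsOne_inl, hsOne_inr, h12, h21]

/-! ### Additivity under freeness with amalgamation -/

variable {N D : StarSubalgebra ℂ M} {E : N →ₗ[ℂ] D}

omit [PartialOrder M] [StarOrderedRing M] in
theorem IsFreeWithAmalgamation.symm {A₁ A₂ : StarSubalgebra ℂ M}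
    (hF : IsFreeWithAmalgamation E A₁ A₂) : IsFreeWithAmalgamation E A₂ A₁ := by
  refine ⟨hF.le_right, hF.le_left, hF.right_le, hF.left_le, fun w hw0 hw hc => ?_⟩
  have := hF.alternating (w.map (Prod.map not id)) (by simpa using hw0) ?_ ?_
  · rwa [List.map_map] at this
  · rw [List.isChain_map]
    exact hw.imp fun p q hpq => by simpa using hpq
  · simp only [List.mem_map]
    rintro _ ⟨⟨b, x⟩, hp, rfl⟩
    have := hc _ hp
    cases b <;> simpa using this

/-- Enlarging the coefficient algebra by a free factor does not increase the irregularity. -/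
theorem freeSteinIrregularity_sq_le_of_free {B A₂ R : StarSubalgebra ℂ M} {X : I → M}
    (hτ : ∀ x y, τ (x * y) = τ (y * x)) (hE : IsTracePreservingCondExp τ N D E)
    (hF : IsFreeWithAmalgamation E (adjoinTuple B X) A₂) (hDB : D ≤ B) (hB : B ≤ R)
    (hA : A₂ ≤ R) (hR : R ≤ B ⊔ A₂) :
    freeSteinIrregularity τ X R ^ 2 ≤ freeSteinIrregularity τ X B ^ 2 := by
  refine le_freeSteinIrregularity_sq fun Ξ A hker => ?_
  rw [isFreeSteinKernel_iff] at hker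
  -- Moving each `ξ` into `L²(B⟨X⟩)` leaves the kernel, and so its distance to the identity,
  -- unchanged.
  choose Η hΗ hrow using fun j => (hker j).exists_mem_L2Of
  exact freeSteinIrregularity_sq_le (isFreeSteinKernel_iff.2 fun j =>
    (hrow j).of_free hτ hE hF hDB hB hA hR (hΗ j))

/-- Since `(B ∨ C)⟨Y⟩ = B ∨ C⟨Y⟩`, the larger coefficient algebra arises from `B` by adjoining the
free factor `C⟨Y⟩`; the same holds with the roles exchanged. -/
theorem add_le_of_free {B C : StarSubalgebra ℂ M} {X : I → M} {Y : J → M}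
    (hτ : ∀ x y, τ (x * y) = τ (y * x)) (hE : IsTracePreservingCondExp τ N D E)
    (hF : IsFreeWithAmalgamation E (adjoinTuple B X) (adjoinTuple C Y)) (hDB : D ≤ B)
    (hDC : D ≤ C) :
    freeSteinIrregularity τ X (adjoinTuple (B ⊔ C) Y) ^ 2
      + freeSteinIrregularity τ Y (adjoinTuple (B ⊔ C) X) ^ 2
      ≤ freeSteinIrregularity τ X B ^ 2 + freeSteinIrregularity τ Y C ^ 2 := by
  refine add_le_add
    (freeSteinIrregularity_sq_le_of_free hτ hE hF hDB (le_sup_left.trans (le_adjoinTuple _ _))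
      (sup_le_sup_right le_sup_right _) ?_)
    (freeSteinIrregularity_sq_le_of_free hτ hE hF.symm hDC
      (le_sup_right.trans (le_adjoinTuple _ _)) (sup_le_sup_right le_sup_left _) ?_)
  · rw [adjoinTuple, sup_assoc]; rfl
  · rw [adjoinTuple, sup_comm B C, sup_assoc]; rfl

theorem freeSteinIrregularity_sq_eq_add_of_free {B C : StarSubalgebra ℂ M} {X : I → M} {Y : J → M}
    (hτ : ∀ x y, τ (x * y) = τ (y * x)) (hE : IsTracePreservingCondExp τ N D E)
    (hF : IsFreeWithAmalgamation E (adjoinTuple B X) (adjoinTuple C Y)) (hDB : D ≤ B)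
    (hDC : D ≤ C) :
    freeSteinIrregularity τ (Sum.elim X Y) (B ⊔ C) ^ 2 =
      freeSteinIrregularity τ X B ^ 2 + freeSteinIrregularity τ Y C ^ 2 :=
  le_antisymm ((freeSteinIrregularity_sq_le_add X Y (B ⊔ C)).trans (add_le_of_free hτ hE hF hDB hDC))
    (add_le_freeSteinIrregularity_sq X Y B C)

/-! ### Free independence as freeness over the scalars -/

omit [StarOrderedRing M] in
/-- A tracial state as a conditional expectation onto the scalars. -/
noncomputable def scalarCondExp (τ : M →ₚ[ℂ] ℂ) :
    (⊤ : StarSubalgebra ℂ M) →ₗ[ℂ] (⊥ : StarSubalgebra ℂ M) :=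
  Algebra.linearMap ℂ (⊥ : StarSubalgebra ℂ M) ∘ₗ τ.toLinearMap ∘ₗ
    (⊤ : StarSubalgebra ℂ M).subtype.toLinearMap

omit [StarOrderedRing M] in
theorem coe_scalarCondExp (x : (⊤ : StarSubalgebra ℂ M)) :
    (scalarCondExp τ x : M) = algebraMap ℂ M (τ x) := rfl

theorem isTracePreservingCondExp_scalarCondExp (h1 : τ 1 = 1) :
    IsTracePreservingCondExp τ ⊤ ⊥ (scalarCondExp τ) := by
  have hc : ∀ c : ℂ, τ (algebraMap ℂ M c) = c := fun c => by
    rw [Algebra.algebraMap_eq_smul_one, map_smul, h1, smul_eq_mul, mul_one]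
  refine ⟨bot_le, ?_, ?_, ?_, ?_⟩
  · rintro ⟨x, _⟩ hx
    obtain ⟨c, rfl⟩ := StarSubalgebra.mem_bot.1 hx
    rw [coe_scalarCondExp, hc]
  · rintro ⟨d, _⟩ x ⟨d', _⟩ hd hd'
    obtain ⟨c, rfl⟩ := StarSubalgebra.mem_bot.1 hd
    obtain ⟨c', rfl⟩ := StarSubalgebra.mem_bot.1 hd'
    simp only [coe_scalarCondExp, MulMemClass.coe_mul]
    simp only [Algebra.algebraMap_eq_smul_one, smul_mul_assoc, one_mul, mul_smul_comm, mul_one,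
      map_smul, smul_eq_mul, smul_smul]
    congr 1
    ring
  · intro x
    rw [coe_scalarCondExp, Algebra.algebraMap_eq_smul_one]
    refine smul_nonneg ?_ zero_le_one
    have : (0 : M) ≤ star (x : M) * x := star_mul_self_nonneg _
    simpa using map_nonneg τ this
  · intro x
    rw [coe_scalarCondExp, hc]

omit [StarOrderedRing M] in
theorem IsFreelyIndependent.isFreeWithAmalgamation [Nontrivial M] {A₁ A₂ : StarSubalgebra ℂ M}
    (h : IsFreelyIndependent τ A₁ A₂) : IsFreeWithAmalgamation (scalarCondExp τ) A₁ A₂ := by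
  -- Nontriviality of `M` makes the scalars embed, so centred for the expectation means trace zero.
  have h0 : ∀ x, scalarCondExp τ x = 0 ↔ τ (x : M) = 0 := fun x => by
    rw [← ZeroMemClass.coe_eq_zero, coe_scalarCondExp, map_eq_zero]
  refine ⟨bot_le, bot_le, le_top, le_top, fun w hw0 hw hc => ?_⟩
  have := h (w.map (Prod.map id Subtype.val)) (by simpa using hw0) ?_ ?_
  · rw [h0, ← StarSubalgebra.subtype_apply, map_list_prod, List.map_map]
    rwa [List.map_map] at this
  · rw [List.isChain_map]
    exact hw
  · simp only [List.mem_map]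
    rintro _ ⟨p, hp, rfl⟩
    exact ⟨(hc p hp).1, (h0 _).1 (hc p hp).2⟩

/-! ### From squared irregularities to dimensions -/

theorem freeSteinIrregularity_sq_toReal_add {K : Type*} [Fintype K] [DecidableEq K]
    (X : I → M) (Y : J → M) (Z : K → M) (B C R : StarSubalgebra ℂ M) :
    (freeSteinIrregularity τ X B ^ 2 + freeSteinIrregularity τ Y C ^ 2
        ≤ freeSteinIrregularity τ Z R ^ 2 ↔
      (freeSteinIrregularity τ X B).toReal ^ 2 + (freeSteinIrregularity τ Y C).toReal ^ 2
        ≤ (freeSteinIrregularity τ Z R).toReal ^ 2) ∧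
    (freeSteinIrregularity τ Z R ^ 2
        ≤ freeSteinIrregularity τ X B ^ 2 + freeSteinIrregularity τ Y C ^ 2 ↔
      (freeSteinIrregularity τ Z R).toReal ^ 2
        ≤ (freeSteinIrregularity τ X B).toReal ^ 2
          + (freeSteinIrregularity τ Y C).toReal ^ 2) := by
  have hX := ENNReal.pow_ne_top (n := 2) (freeSteinIrregularity_ne_top τ X B)
  have hY := ENNReal.pow_ne_top (n := 2) (freeSteinIrregularity_ne_top τ Y C)
  have hZ := ENNReal.pow_ne_top (n := 2) (freeSteinIrregularity_ne_top τ Z R)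
  rw [← ENNReal.toReal_le_toReal (ENNReal.add_ne_top.2 ⟨hX, hY⟩) hZ,
    ← ENNReal.toReal_le_toReal hZ (ENNReal.add_ne_top.2 ⟨hX, hY⟩), ENNReal.toReal_add hX hY]
  simp only [ENNReal.toReal_pow, and_self]

/-- The numbers of variables add up and cancel, and the sign reverses the inequality. -/
theorem freeSteinDim_le_add_iff (X : I → M) (Y : J → M) (B C R : StarSubalgebra ℂ M) :
    freeSteinDim τ (Sum.elim X Y) R ≤ freeSteinDim τ X B + freeSteinDim τ Y C ↔
      freeSteinIrregularity τ X B ^ 2 + freeSteinIrregularity τ Y C ^ 2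
        ≤ freeSteinIrregularity τ (Sum.elim X Y) R ^ 2 := by
  rw [(freeSteinIrregularity_sq_toReal_add X Y (Sum.elim X Y) B C R).1, freeSteinDim, freeSteinDim,
    freeSteinDim, Fintype.card_sum]
  push_cast
  constructor <;> intro h <;> linarith

theorem add_le_freeSteinDim_iff (X : I → M) (Y : J → M) (B C R : StarSubalgebra ℂ M) :
    freeSteinDim τ X B + freeSteinDim τ Y C ≤ freeSteinDim τ (Sum.elim X Y) R ↔
      freeSteinIrregularity τ (Sum.elim X Y) R ^ 2
        ≤ freeSteinIrregularity τ X B ^ 2 + freeSteinIrregularity τ Y C ^ 2 := by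
  rw [(freeSteinIrregularity_sq_toReal_add X Y (Sum.elim X Y) B C R).2, freeSteinDim, freeSteinDim,
    freeSteinDim, Fintype.card_sum]
  push_cast
  constructor <;> intro h <;> linarith

theorem freeSteinDim_eq_add_iff (X : I → M) (Y : J → M) (B C R : StarSubalgebra ℂ M) :
    freeSteinDim τ (Sum.elim X Y) R = freeSteinDim τ X B + freeSteinDim τ Y C ↔
      freeSteinIrregularity τ (Sum.elim X Y) R ^ 2
        = freeSteinIrregularity τ X B ^ 2 + freeSteinIrregularity τ Y C ^ 2 := by
  rw [le_antisymm_iff, le_antisymm_iff, freeSteinDim_le_add_iff, add_le_freeSteinDim_iff, and_comm]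

end Irregularity

theorem mainTheorem7 {M : Type*} [CStarAlgebra M] [PartialOrder M] [StarOrderedRing M]
    [WStarAlgebra M] (τ : M →ₚ[ℂ] ℂ) (hτ : IsFaithfulNormalTracialState τ)
    (B C : StarSubalgebra ℂ M) {n m : ℕ} (X : Fin n → M) (Y : Fin m → M)
    (hX : IsStarClosed X) (hY : IsStarClosed Y) :
    -- the two inequalities for the irregularity
    (freeSteinIrregularity τ X B ^ 2 + freeSteinIrregularity τ Y C ^ 2
        ≤ freeSteinIrregularity τ (Sum.elim X Y) (B ⊔ C) ^ 2 ∧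
      freeSteinIrregularity τ (Sum.elim X Y) (B ⊔ C) ^ 2
        ≤ freeSteinIrregularity τ X (adjoinTuple (B ⊔ C) Y) ^ 2
          + freeSteinIrregularity τ Y (adjoinTuple (B ⊔ C) X) ^ 2) ∧
    -- the two inequalities for the dimension
    (freeSteinDim τ X (adjoinTuple (B ⊔ C) Y) + freeSteinDim τ Y (adjoinTuple (B ⊔ C) X)
        ≤ freeSteinDim τ (Sum.elim X Y) (B ⊔ C) ∧
      freeSteinDim τ (Sum.elim X Y) (B ⊔ C) ≤ freeSteinDim τ X B + freeSteinDim τ Y C) ∧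
    -- equality under freeness with amalgamation over a common subalgebra `D`
    (∀ (D : StarSubalgebra ℂ M) (E : adjoinTuple (B ⊔ C) (Sum.elim X Y) →ₗ[ℂ] D),
      D ≤ B → D ≤ C →
      IsTracePreservingCondExp τ (adjoinTuple (B ⊔ C) (Sum.elim X Y)) D E →
      IsFreeWithAmalgamation E (adjoinTuple B X) (adjoinTuple C Y) →
      (freeSteinIrregularity τ X B ^ 2 + freeSteinIrregularity τ Y C ^ 2
          = freeSteinIrregularity τ (Sum.elim X Y) (B ⊔ C) ^ 2 ∧
        freeSteinIrregularity τ (Sum.elim X Y) (B ⊔ C) ^ 2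
          = freeSteinIrregularity τ X (adjoinTuple (B ⊔ C) Y) ^ 2
            + freeSteinIrregularity τ Y (adjoinTuple (B ⊔ C) X) ^ 2) ∧
      (freeSteinDim τ X (adjoinTuple (B ⊔ C) Y) + freeSteinDim τ Y (adjoinTuple (B ⊔ C) X)
          = freeSteinDim τ (Sum.elim X Y) (B ⊔ C) ∧
        freeSteinDim τ (Sum.elim X Y) (B ⊔ C) = freeSteinDim τ X B + freeSteinDim τ Y C)) ∧
    -- additivity when `B⟨X⟩` and `B⟨Y⟩` are free with amalgamation over `B`
    (∀ E : adjoinTuple B (Sum.elim X Y) →ₗ[ℂ] B,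
      IsTracePreservingCondExp τ (adjoinTuple B (Sum.elim X Y)) B E →
      IsFreeWithAmalgamation E (adjoinTuple B X) (adjoinTuple B Y) →
      freeSteinIrregularity τ (Sum.elim X Y) B ^ 2
          = freeSteinIrregularity τ X B ^ 2 + freeSteinIrregularity τ Y B ^ 2 ∧
        freeSteinDim τ (Sum.elim X Y) B = freeSteinDim τ X B + freeSteinDim τ Y B) ∧
    -- additivity over the scalars when `X` and `Y` are free
    (IsFreelyIndependent τ (adjoinTuple ⊥ X) (adjoinTuple ⊥ Y) →
      freeSteinIrregularity τ (Sum.elim X Y) ⊥ ^ 2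
          = freeSteinIrregularity τ X ⊥ ^ 2 + freeSteinIrregularity τ Y ⊥ ^ 2 ∧
        freeSteinDim τ (Sum.elim X Y) ⊥ = freeSteinDim τ X ⊥ + freeSteinDim τ Y ⊥) := by
  have hlow := add_le_freeSteinIrregularity_sq (τ := τ) X Y B C
  have hup := freeSteinIrregularity_sq_le_add (τ := τ) X Y (B ⊔ C)
  refine ⟨⟨hlow, hup⟩, ⟨(add_le_freeSteinDim_iff ..).2 hup, (freeSteinDim_le_add_iff ..).2 hlow⟩,
    ?_, ?_, ?_⟩
  · intro D E hDB hDC hE hF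
    have h1 := freeSteinIrregularity_sq_eq_add_of_free hτ.tracial hE hF hDB hDC
    -- Freeness bounds the largest of the three quantities by the smallest, so the middle one equals
    -- both.
    have h2 := le_antisymm hup
      ((add_le_of_free hτ.tracial hE hF hDB hDC).trans hlow)
    exact ⟨⟨h1.symm, h2⟩, ((freeSteinDim_eq_add_iff ..).2 h2).symm,
      (freeSteinDim_eq_add_iff ..).2 h1⟩
  · intro E hE hF
    have h := freeSteinIrregularity_sq_eq_add_of_free hτ.tracial hE hF le_rfl le_rfl
    rw [sup_idem] at h
    exact ⟨h, (freeSteinDim_eq_add_iff ..).2 h⟩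
  · intro hfree
    have : Nontrivial M := ⟨1, 0, fun h => by simpa [h] using hτ.map_one⟩
    have h := freeSteinIrregularity_sq_eq_add_of_free hτ.tracial
      (isTracePreservingCondExp_scalarCondExp hτ.map_one) hfree.isFreeWithAmalgamation
      le_rfl le_rfl
    rw [sup_idem] at h
    exact ⟨h, (freeSteinDim_eq_add_iff ..).2 h⟩
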